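/- **Setting.** Let $m\ge 1$ and $d$ be integers, $d\ge 0$. Let $\Omega\subset\mathbb R^d$ be compact and satisfy an interior cone condition with radius $r>0$ and angle $\theta\in(0,\pi/2)$: for every $a\in\Omega$ there is a unit vector $\xi$ with $\{a+ty:\ \|y\|=1,\ y\cdot\xi\ge\cos\theta,\ 0\le t\le r\}\subset\Omega$. Put $C(\theta)=\dfrac{16(1+\sin\theta)^2m^2}{3\sin^2\theta}$. Let $\Omega^*\supseteq\Omega$ be a compact set on which derivatives are uniquely determined (in the sense that at each of its points the tangent directions span a dense subspace and the point is not isolated), such that for some $\kappa,\rho>0$ any two points $a,b\in\Omega$ with $\|a-b\|\le\rho$ can be joined by a curve in $\Omega^*$ of length at most $\kappa\|a-b\|$. (The choice $\Omega^*=\Omega$ is allowed whenever $\Omega$ itself has this property, e.g. if $\Omega$ is convex or a Lipschitz domain; a closed ball containing $\Omega$ is always allowed.) Here $C^{m+1}(\Omega^*)$ is the space of functions that are $m+1$ times continuously differentiable on $\Omega^*$, with $\|\phi\|_{C^{m+1}(\Omega^*)}=\max_{0\le k\le m+1}\sup_{z\in\Omega^*}\|D^k\phi(z)\|$ (derivatives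 on $\Omega^*$, operator norms). For points $X=\{x_1,\dots,x_N\}\subset\Omega$ let $h=h_{X,\Omega}=\sup_{z\in\Omega}\min_j\|z-x_j\|$ be the fill distance and $q_X=\frac12\min_{i\ne j}\|x_i-x_j\|$ the separation distance. Assume that $X$ is quasi-uniform with constant $c$, i.e. $q_X\le h\le c\,q_X$, and that $h\le r/C(\theta)$. Put $\delta=2C(\theta)h$. Let $\Phi:[0,\infty)\to[0,\infty)$ be a continuous weight with $\Phi(s)=0$ for $s>\delta$ and $\Phi(s)>0$ for $0\le s<\delta/2$, of a fixed profile: $\Phi(s)=\psi(s/\delta)$ with $\psi$ independent of $X$. For $x_i\in X$ and $\varepsilon\ge\delta$ let $N_i^\varepsilon=\{x_j\in X:\|x_j-x_i\|<\varepsilon\}$, and let $x_{ij}=\frac12(x_i+x_j)$, $x_j\in N_i^\varepsilon$, be the midpoints of the edges from $x_i$. The topological gradient of a nodal function $\phi^h$ is $GRAD_i(\phi^h)_{ij}=\phi^h_j-\phi^h_i$. Let $P^i_m$ be the space of polynomials $p$ of degree at most $m$ with $p(x_i)=0$. For edge values $u=(u_{ij})_j$ let $$p^*=\operatorname*{arg\,min}_{p\in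 P^i_m}\ \sum_{x_j\in N_i^\varepsilon}\bigl[u_{ij}-p(x_{ij})\bigr]^2\,\Phi(\|x_i-x_{ij}\|),\qquad DIV_i(u)=\tfrac14\,\widetilde\Delta p^*(x_i),$$ where, if $p^*=\sum_k b_kp_k$ in a basis $\{p_k\}$ of $P^i_m$, $\widetilde\Delta p^*(x_i)=\sum_kb_k\Delta p_k(x_i)$ and $\widetilde\nabla p^*(x_i)=\sum_kb_k\nabla p_k(x_i)$. **Theorem 5.1.** There is a constant $C>0$, depending only on $d,m,\Omega,r,\theta,\Omega^*,c$ and $\psi$ (not on $X$, $h$, $x_i$, $\varepsilon$ or $\phi$), such that for all $X$, $\Phi$, $x_i\in X$ and $\varepsilon$ as above and all $\phi\in C^{m+1}(\Omega^*)$, with interpolant $\phi^h_j=\phi(x_j)$: the least-squares problem with data $u=GRAD_i(\phi^h)$ has exactly one solution $p^*$, and $$\bigl|\Delta\phi(x_i)-DIV_i\circ GRAD_i(\phi^h)\bigr|\le C\,h^{m-1}\,\|\phi\|_{C^{m+1}(\Omega^*)},$$ $$\bigl\|\nabla\phi(x_i)-\tfrac12\widetilde\nabla p^*(x_i)\bigr\|\le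 C\,h^{m}\,\|\phi\|_{C^{m+1}(\Omega^*)}.$$ -/

import Mathlib

noncomputable section

namespace StaggeredGMLS

/-- Euclidean space `ℝ^d` with the Euclidean norm. -/
abbrev Pt (d : ℕ) : Type := EuclideanSpace ℝ (Fin d)

/-! ## The domain -/

/-- The closed cone of apex `a`, axis `ξ` (a unit vector), half-angle `θ` and radius `r`:
the points `a + t y` with `‖y‖ = 1`, `⟪y, ξ⟫ ≥ cos θ` and `0 ≤ t ≤ r`. -/
def cone {d : ℕ} (a ξ : Pt d) (θ r : ℝ) : Set (Pt d) :=
  {z | ∃ (y : Pt d) (t : ℝ), ‖y‖ = 1 ∧ Real.cos θ ≤ inner ℝ y ξ ∧ 0 ≤ t ∧ t ≤ r ∧ z = a + t • y}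

/-- Interior cone condition with radius `r` and angle `θ`: every point of `Ω` is the apex of a
cone of that radius and angle which is contained in `Ω`. -/
def InteriorConeCondition {d : ℕ} (Ω : Set (Pt d)) (r θ : ℝ) : Prop :=
  ∀ a ∈ Ω, ∃ ξ : Pt d, ‖ξ‖ = 1 ∧ cone a ξ θ r ⊆ Ω

/-- The condition on the domain: compact, with an interior cone condition of radius `r > 0` and
angle `θ ∈ (0, π/2)`. -/
structure DomainCondition {d : ℕ} (Ω : Set (Pt d)) (r θ : ℝ) : Prop where
  compact : IsCompact Ω
  radius_pos : 0 < r
  angle_pos : 0 < θ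
  angle_lt : θ < Real.pi / 2
  cone_condition : InteriorConeCondition Ω r θ

/-- Any two points of `Ω` at distance at most `ρ` can be joined by a curve in `S` of length at most
`κ` times their distance. (The curve is parametrized on `[0,1]`, with Lipschitz constant
`κ ‖a - b‖`; `S` convex and `κ = 1` is the simplest example.) -/
def JoinedByShortCurves {d : ℕ} (Ω S : Set (Pt d)) (κ ρ : ℝ) : Prop :=
  ∀ a ∈ Ω, ∀ b ∈ Ω, dist a b ≤ ρ →
    ∃ γ : ℝ → Pt d, γ 0 = a ∧ γ 1 = b ∧
      (∀ t ∈ Set.Icc (0 : ℝ) 1, γ t ∈ S) ∧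
      (∀ s ∈ Set.Icc (0 : ℝ) 1, ∀ t ∈ Set.Icc (0 : ℝ) 1,
        dist (γ s) (γ t) ≤ κ * dist a b * |s - t|)

/-- `S` is a set on which smoothness of functions given on `Ω` may be measured: a compact set
containing `Ω`, on which derivatives are unique, and in which nearby points of `Ω` can be joined by
curves of comparable length. `S = Ω` is allowed if `Ω` is, e.g., convex or a Lipschitz domain; a
compact convex set, or a closed tubular neighbourhood of `Ω`, is always allowed. -/
structure RegularityRegion {d : ℕ} (Ω S : Set (Pt d)) : Prop where
  subset : Ω ⊆ S
  compact : IsCompact S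
  uniqueDiff : UniqueDiffOn ℝ S
  joined : ∃ κ ρ : ℝ, 0 < ρ ∧ JoinedByShortCurves Ω S κ ρ

/-- The norm of `C^n(S)`, `S` compact: the largest value on `S` of a derivative of order `≤ n`. -/
def ckNorm {d : ℕ} (n : ℕ) (S : Set (Pt d)) (φ : Pt d → ℝ) : ℝ :=
  sSup {c : ℝ | ∃ k ≤ n, ∃ z ∈ S, c = ‖iteratedFDerivWithin ℝ k φ S z‖}

/-! ## The nodes -/

/-- The constant `C(θ) = 16 (1 + sin θ)² m² / (3 sin² θ)`. -/
def coneConst (m : ℕ) (θ : ℝ) : ℝ :=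
  16 * (1 + Real.sin θ) ^ 2 * (m : ℝ) ^ 2 / (3 * Real.sin θ ^ 2)

/-- Fill distance `h_{X,Ω} = sup_{z ∈ Ω} min_j ‖z - x_j‖`. -/
def fillDistance {d N : ℕ} (x : Fin N → Pt d) (Ω : Set (Pt d)) : ℝ :=
  sSup ((fun z => Metric.infDist z (Set.range x)) '' Ω)

/-- Separation distance `q_X = ½ min_{i ≠ j} ‖x_i - x_j‖`. -/
def separationDistance {d N : ℕ} (x : Fin N → Pt d) : ℝ :=
  sInf {c : ℝ | ∃ i j : Fin N, i ≠ j ∧ c = dist (x i) (x j)} / 2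

/-- The condition on the nodes: they lie in `Ω`, are quasi-uniform with constant `c`, that is
`q_X ≤ h_{X,Ω} ≤ c q_X`, and have fill distance at most `h₀ = r / C(θ)`. -/
structure NodeCondition {d N : ℕ} (Ω : Set (Pt d)) (r θ : ℝ) (m : ℕ) (c : ℝ)
    (x : Fin N → Pt d) : Prop where
  mem : ∀ j, x j ∈ Ω
  sep_le_fill : separationDistance x ≤ fillDistance x Ω
  fill_le_sep : fillDistance x Ω ≤ c * separationDistance x
  fill_le : fillDistance x Ω ≤ r / coneConst m θ

/-! ## The weight -/

/-- The condition on the (radial, continuous, nonnegative) weight `z ↦ Φ ‖z‖`: supported in the ball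
of radius `δ` about the origin and positive in the ball of radius `δ / 2`. -/
structure WeightCondition (Φ : ℝ → ℝ) (δ : ℝ) : Prop where
  cont : ContinuousOn Φ (Set.Ici 0)
  nonneg : ∀ s, 0 ≤ s → 0 ≤ Φ s
  support : ∀ s, δ < s → Φ s = 0
  pos : ∀ s, 0 ≤ s → s < δ / 2 → 0 < Φ s

/-! ## Local primal grid, vertex and edge spaces, topological gradient -/

/-- Indices of the nodes in the `ε`-neighbourhood of `x i`; they also label the local edges
`e_ij = x_j - x_i` and the virtual faces dual to them. -/
abbrev Nbr {d N : ℕ} (x : Fin N → Pt d) (ε : ℝ) (i : Fin N) : Type :=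
  {j : Fin N // ‖x j - x i‖ < ε}

instance {d N : ℕ} (x : Fin N → Pt d) (ε : ℝ) (i : Fin N) : Fintype (Nbr x ε i) :=
  Fintype.ofFinite _

/-- Local vertex space `V^i`. -/
abbrev VertexSpace {d N : ℕ} (x : Fin N → Pt d) (ε : ℝ) (i : Fin N) : Type := Nbr x ε i → ℝ

/-- Local edge space `E^i`, identified with the face space `F^i` through `e_ij ↔ f_ij`. -/
abbrev EdgeSpace {d N : ℕ} (x : Fin N → Pt d) (ε : ℝ) (i : Fin N) : Type := Nbr x ε i → ℝ

/-- Restriction to `V^i` of a global nodal function. -/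
def restrictNodal {d N : ℕ} (x : Fin N → Pt d) (ε : ℝ) (i : Fin N) (u : Fin N → ℝ) :
    VertexSpace x ε i :=
  fun j => u j

/-- The topological gradient `GRAD_i : V^i → E^i`, `u_ij = u_j - u_i`. -/
def topGrad {d N : ℕ} (x : Fin N → Pt d) {ε : ℝ} (hε : 0 < ε) (i : Fin N)
    (u : VertexSpace x ε i) : EdgeSpace x ε i :=
  fun j => u j - u ⟨i, by simpa using hε⟩

/-- The midpoint `x_ij = (x_i + x_j) / 2`. -/
def edgeMid {d N : ℕ} (x : Fin N → Pt d) (i j : Fin N) : Pt d := (1 / 2 : ℝ) • (x i + x j)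

/-! ## Polynomials -/

/-- The value of a polynomial at a point. -/
def polyEval {d : ℕ} (z : Pt d) (p : MvPolynomial (Fin d) ℝ) : ℝ :=
  MvPolynomial.eval (fun k => z k) p

/-- The space `P_m^i` of polynomials of degree at most `m` that vanish at `a = x_i`. -/
def vanishingPoly {d : ℕ} (m : ℕ) (a : Pt d) : Set (MvPolynomial (Fin d) ℝ) :=
  {p | p.totalDegree ≤ m ∧ polyEval a p = 0}

/-- The gradient of a polynomial at a point. -/
def polyGrad {d : ℕ} (z : Pt d) (p : MvPolynomial (Fin d) ℝ) : Pt d :=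
  WithLp.toLp 2 (fun k => polyEval z (MvPolynomial.pderiv k p))

/-- The Laplacian of a polynomial at a point. -/
def polyLaplacian {d : ℕ} (z : Pt d) (p : MvPolynomial (Fin d) ℝ) : ℝ :=
  ∑ k : Fin d, polyEval z (MvPolynomial.pderiv k (MvPolynomial.pderiv k p))

/-! ## GMLS fit from edge data, discrete divergence and flux -/

/-- The weighted least-squares functional
`∑_j (u_ij - p(x_ij))² Φ(‖x_i - x_ij‖)`, the sum being over the local edges. -/
def lsqFunctional {d N : ℕ} (Φ : ℝ → ℝ) (x : Fin N → Pt d) (ε : ℝ) (i : Fin N)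
    (u : EdgeSpace x ε i) (p : MvPolynomial (Fin d) ℝ) : ℝ :=
  ∑ j : Nbr x ε i, (u j - polyEval (edgeMid x i j) p) ^ 2 * Φ ‖x i - edgeMid x i j‖

/-- `p` minimizes the weighted least-squares functional over `P_m^i`. -/
def IsFit {d N : ℕ} (m : ℕ) (Φ : ℝ → ℝ) (x : Fin N → Pt d) (ε : ℝ) (i : Fin N)
    (u : EdgeSpace x ε i) (p : MvPolynomial (Fin d) ℝ) : Prop :=
  p ∈ vanishingPoly m (x i) ∧ IsMinOn (lsqFunctional Φ x ε i u) (vanishingPoly m (x i)) p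

open Classical in
/-- The polynomial `p*` fitted at `x_i` to the edge data `u`. -/
def gmlsFit {d N : ℕ} (m : ℕ) (Φ : ℝ → ℝ) (x : Fin N → Pt d) (ε : ℝ) (i : Fin N)
    (u : EdgeSpace x ε i) : MvPolynomial (Fin d) ℝ :=
  if h : ∃ p, IsFit m Φ x ε i u p then h.choose else 0

/-- The discrete divergence `DIV_i u = ¼ Δ̃p*(x_i)`. The GMLS Laplacian of `p* = ∑ b_k p_k` is
`∑ b_k Δp_k(x_i)`, the coefficients `b_k` being those fitted at `x_i`; by linearity this is the
Laplacian at `x_i` of the one polynomial `gmlsFit`. -/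
def gmlsDiv {d N : ℕ} (m : ℕ) (Φ : ℝ → ℝ) (x : Fin N → Pt d) (ε : ℝ) (i : Fin N)
    (u : EdgeSpace x ε i) : ℝ :=
  (1 / 4) * polyLaplacian (x i) (gmlsFit m Φ x ε i u)

/-- The reconstructed vector field `½ ∇̃p*(x_i)`, where `∇̃p*(x_i) = ∑ b_k ∇p_k(x_i)`. -/
def gmlsField {d N : ℕ} (m : ℕ) (Φ : ℝ → ℝ) (x : Fin N → Pt d) (ε : ℝ) (i : Fin N)
    (u : EdgeSpace x ε i) : Pt d :=
  (1 / 2 : ℝ) • polyGrad (x i) (gmlsFit m Φ x ε i u)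

end StaggeredGMLS

end

/-!
Let `T` be the Taylor polynomial of `φ` at `x i`. The polynomial
`q w = T (x i + 2 (w - x i)) - T (x i)` vanishes at `x i` and takes the value `T (x j) - T (x i)`
at the midpoint of the edge from `x i` to `x j`, so by Taylor's theorem along short curves it fits
the data up to `O(h ^ (m + 1))`. Its gradient at `x i` is `2 ∇φ (x i)` and, if `2 ≤ m`, its
Laplacian there is `4 Δφ (x i)`; this uses the symmetry of the derivatives of `φ` within `S`,
which holds at limits of interior points of `S`, and the cone condition makes every point of `Ω`
such a limit.

Conversely the fit is stable. By Markov's inequality the midpoints of the edges of length at most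
`coneConst m θ * h` form a norming set for the polynomials of degree at most `m` on a cone with
apex `x i` which contains a ball of radius `2 m ^ 2 h`, and Markov's inequality once more bounds
the derivatives at `x i` by negative powers of `h`. The least-squares distance from the fit to `q`
is at most twice the misfit of `q`, which gives uniqueness and both rates.
-/

noncomputable section

namespace StaggeredGMLS

section Markov

open Polynomial

theorem abs_derivative_eval_one_le {P : ℝ[X]} {m : ℕ} (hP : P.natDegree ≤ m) {M : ℝ}
    (hM : ∀ t ∈ Set.Icc (-1 : ℝ) 1, |P.eval t| ≤ M) :
    |P.derivative.eval 1| ≤ (m : ℝ) ^ 2 * M := by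
  have hM0 : 0 ≤ M := (abs_nonneg _).trans (hM 1 (by simp))
  rcases hM0.eq_or_lt with rfl | hpos
  · have hP0 : P = 0 := eq_zero_of_infinite_isRoot P <|
      (Set.Icc_infinite (by norm_num : (-1 : ℝ) < 1)).mono fun t ht =>
        abs_nonpos_iff.1 (hM t ht)
    simp [hP0]
  have scaled : ∀ c : ℝ, |c| = 1 → c / M * P.derivative.eval 1 ≤ (m : ℝ) ^ 2 := fun c hc => by
    have hdeg : (C (c / M) * P).degree ≤ m :=
      natDegree_le_iff_degree_le.1 ((natDegree_C_mul_le _ _).trans hP)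
    have hbound : ∀ t ∈ Set.Icc (-1 : ℝ) 1, |(C (c / M) * P).eval t| ≤ 1 := fun t ht => by
      rw [eval_C_mul, abs_mul, abs_div, hc, abs_of_pos hpos, one_div_mul_eq_div, div_le_one hpos]
      exact hM t ht
    have h := Chebyshev.eval_iterate_derivative_le_of_forall_abs_le_one (k := 1) le_rfl hdeg hbound
    simpa [Chebyshev.T_derivative_eq_U, sq] using h
  have hle := scaled 1 (by simp)
  have hge := scaled (-1) (by simp)
  rw [div_mul_eq_mul_div, div_le_iff₀ hpos] at hle hge
  exact abs_le.2 ⟨by linarith, by linarith⟩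

theorem mul_abs_derivative_eval_left_le {Q : ℝ[X]} {m : ℕ} (hQ : Q.natDegree ≤ m) {a b M : ℝ}
    (hab : a ≤ b) (hM : ∀ t ∈ Set.Icc a b, |Q.eval t| ≤ M) :
    (b - a) * |Q.derivative.eval a| ≤ 2 * (m : ℝ) ^ 2 * M := by
  set L : ℝ[X] := C ((a + b) / 2) - C ((b - a) / 2) * X with hL
  have hdeg : (Q.comp L).natDegree ≤ m := by
    have hL1 : L.natDegree ≤ 1 := by rw [hL]; compute_degree
    exact natDegree_comp_le.trans ((Nat.mul_le_mul hQ hL1).trans_eq (mul_one m))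
  have h := abs_derivative_eval_one_le (M := M) hdeg fun t ht => by
    rw [eval_comp]
    refine hM _ ?_
    simp only [hL, eval_sub, eval_mul, eval_C, eval_X]
    constructor <;> nlinarith [ht.1, ht.2]
  have hLa : L.eval 1 = a := by simp only [hL, eval_sub, eval_mul, eval_C, eval_X]; ring
  have hL' : L.derivative = C (-((b - a) / 2)) := by simp [hL]
  rw [derivative_comp, eval_mul, eval_comp, hLa, hL', eval_C, abs_mul, abs_neg,
    abs_of_nonneg (by linarith)] at h
  linarith

theorem abs_eval_sub_eval_left_le {Q : ℝ[X]} {m : ℕ} (hQ : Q.natDegree ≤ m) {a b l M : ℝ}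
    (hM : ∀ t ∈ Set.Icc a b, |Q.eval t| ≤ M) (hal : a ≤ l) (hlb : l < b) :
    |Q.eval l - Q.eval a| ≤ 2 * (m : ℝ) ^ 2 * M / (b - l) * (l - a) := by
  have hderiv : ∀ t ∈ Set.Icc a l, ‖Q.derivative.eval t‖ ≤ 2 * (m : ℝ) ^ 2 * M / (b - l) := by
    intro t ht
    have h := mul_abs_derivative_eval_left_le hQ (ht.2.trans hlb.le) fun u hu =>
      hM u ⟨ht.1.trans hu.1, hu.2⟩
    rw [Real.norm_eq_abs, le_div_iff₀' (by linarith)]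
    exact (mul_le_mul_of_nonneg_right (by linarith [ht.2]) (abs_nonneg _)).trans h
  simpa [abs_of_nonneg (sub_nonneg.2 hal)] using
    (convex_Icc a l).norm_image_sub_le_of_norm_hasDerivWithin_le
      (fun t _ => (Q.hasDerivAt t).hasDerivWithinAt) hderiv
      (Set.left_mem_Icc.2 hal) (Set.right_mem_Icc.2 hal)

end Markov

section PolynomialCalculus

variable {d m : ℕ} {p : MvPolynomial (Fin d) ℝ}

theorem polyEval_sub (z : Pt d) (p q : MvPolynomial (Fin d) ℝ) :
    polyEval z (p - q) = polyEval z p - polyEval z q :=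
  map_sub _ p q

theorem polyGrad_sub (z : Pt d) (p q : MvPolynomial (Fin d) ℝ) :
    polyGrad z (p - q) = polyGrad z p - polyGrad z q := by
  ext k
  simp [polyGrad, polyEval_sub]

theorem polyLaplacian_sub (z : Pt d) (p q : MvPolynomial (Fin d) ℝ) :
    polyLaplacian z (p - q) = polyLaplacian z p - polyLaplacian z q := by
  simp [polyLaplacian, polyEval_sub, Finset.sum_sub_distrib]

theorem contDiff_polyEval (p : MvPolynomial (Fin d) ℝ) {n : WithTop ℕ∞} :
    ContDiff ℝ n fun z : Pt d => polyEval z p := by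
  induction p using MvPolynomial.induction_on with
  | C c => simpa [polyEval] using contDiff_const
  | add p q hp hq => simpa [polyEval] using hp.add hq
  | mul_X p k hp =>
    have hk : ContDiff ℝ n fun z : Pt d => z k := by fun_prop
    simpa [polyEval] using hp.mul hk

theorem hasGradientAt_polyEval (p : MvPolynomial (Fin d) ℝ) (z : Pt d) :
    HasGradientAt (fun z : Pt d => polyEval z p) (polyGrad z p) z := by
  rw [hasGradientAt_iff_hasFDerivAt]
  induction p using MvPolynomial.induction_on with
  | C c =>
    have hgrad : polyGrad z (MvPolynomial.C c) = 0 := by ext k; simp [polyGrad, polyEval]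
    simpa [hgrad, polyEval] using hasFDerivAt_const c z
  | add p q hp hq =>
    have hgrad : polyGrad z (p + q) = polyGrad z p + polyGrad z q := by
      ext k; simp [polyGrad, polyEval]
    simpa [hgrad, polyEval] using hp.fun_add hq
  | mul_X p k hp =>
    have hgrad : polyGrad z (p * MvPolynomial.X k)
        = polyEval z p • EuclideanSpace.single k (1 : ℝ) + z k • polyGrad z p := by
      ext l
      simp [polyGrad, polyEval, Derivation.leibniz, MvPolynomial.pderiv_X, Pi.single_apply, eq_comm,
        apply_ite (MvPolynomial.eval _)]
    have hk : HasFDerivAt (fun z : Pt d => z k) (EuclideanSpace.proj k : Pt d →L[ℝ] ℝ) z :=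
      (EuclideanSpace.proj k : Pt d →L[ℝ] ℝ).hasFDerivAt
    have hsingle : InnerProductSpace.toDual ℝ (Pt d) (EuclideanSpace.single k (1 : ℝ))
        = (EuclideanSpace.proj k : Pt d →L[ℝ] ℝ) := by
      ext v; simp [EuclideanSpace.inner_single_left]
    simpa [hgrad, hsingle, polyEval] using hp.fun_mul hk

theorem inner_single_polyGrad (p : MvPolynomial (Fin d) ℝ) (z : Pt d) (k : Fin d) :
    inner ℝ (polyGrad z p) (EuclideanSpace.single k (1 : ℝ))
      = polyEval z (MvPolynomial.pderiv k p) := by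
  simp [polyGrad, EuclideanSpace.inner_single_right]

theorem gradient_polyEval (p : MvPolynomial (Fin d) ℝ) (z : Pt d) :
    gradient (fun z : Pt d => polyEval z p) z = polyGrad z p :=
  (hasGradientAt_polyEval p z).gradient

theorem laplacian_polyEval (p : MvPolynomial (Fin d) ℝ) (z : Pt d) :
    Laplacian.laplacian (fun z : Pt d => polyEval z p) z = polyLaplacian z p := by
  have hpartial (q : MvPolynomial (Fin d) ℝ) (k : Fin d) (w : Pt d) :
      fderiv ℝ (fun z : Pt d => polyEval z q) w (EuclideanSpace.single k (1 : ℝ))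
        = polyEval w (MvPolynomial.pderiv k q) := by
    rw [(hasGradientAt_polyEval q w).fderiv_apply, inner_single_polyGrad]
  have hdiff : DifferentiableAt ℝ (fderiv ℝ fun z : Pt d => polyEval z p) z :=
    ((contDiff_polyEval p (n := 2)).fderiv_right (m := 1) (by norm_num)).differentiable
      one_ne_zero z
  rw [InnerProductSpace.laplacian_eq_iteratedFDeriv_orthonormalBasis _
    (EuclideanSpace.basisFun (Fin d) ℝ), polyLaplacian]
  refine Finset.sum_congr rfl fun k _ => ?_
  rw [iteratedFDeriv_two_apply, ← hpartial, ← funext (hpartial p k),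
    fderiv_clm_apply hdiff (differentiableAt_const _)]
  simp

theorem totalDegree_pderiv_le {σ R : Type*} [CommSemiring R] (k : σ) (p : MvPolynomial σ R) :
    (MvPolynomial.pderiv k p).totalDegree ≤ p.totalDegree := by
  classical
  conv_lhs => rw [p.as_sum, map_sum]
  refine MvPolynomial.totalDegree_finsetSum_le fun s hs => ?_
  rw [MvPolynomial.pderiv_monomial]
  calc _ ≤ (s - Finsupp.single k 1).degree := MvPolynomial.totalDegree_monomial_le _ _
    _ ≤ s.degree := Finsupp.degree_mono tsub_le_self
    _ ≤ p.totalDegree := MvPolynomial.le_totalDegree hs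

/-- The univariate polynomial `t ↦ p (z + t v)`: the restriction of `p` to a line, which reduces
estimates for `p` to the one-variable Markov inequality. -/
def lineRestrict (z v : Pt d) (p : MvPolynomial (Fin d) ℝ) : Polynomial ℝ :=
  MvPolynomial.aeval (fun k => Polynomial.C (z k) + Polynomial.C (v k) * Polynomial.X) p

theorem natDegree_lineRestrict_le (z v : Pt d) (hp : p.totalDegree ≤ m) :
    (lineRestrict z v p).natDegree ≤ m := by
  simpa [lineRestrict] using MvPolynomial.aeval_natDegree_le p hp
    (fun k => Polynomial.C (z k) + Polynomial.C (v k) * Polynomial.X) (n := 1)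
    (fun k => by compute_degree)

theorem eval_lineRestrict (z v : Pt d) (p : MvPolynomial (Fin d) ℝ) (t : ℝ) :
    (lineRestrict z v p).eval t = polyEval (z + t • v) p := by
  induction p using MvPolynomial.induction_on with
  | C c => simp [lineRestrict, polyEval]
  | add p q hp hq => simp_all [lineRestrict, polyEval]
  | mul_X p k hp =>
    simp only [lineRestrict, polyEval, map_mul, Polynomial.eval_mul] at hp ⊢
    rw [hp]
    simp [mul_comm t]

theorem derivative_lineRestrict_eval_zero (z v : Pt d) (p : MvPolynomial (Fin d) ℝ) :
    (lineRestrict z v p).derivative.eval 0 = inner ℝ (polyGrad z p) v := by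
  have hline : HasDerivAt (fun t : ℝ => z + t • v) v 0 := by
    simpa using ((hasDerivAt_id (0 : ℝ)).smul_const v).const_add z
  have hgrad := (hasGradientAt_polyEval p (z + (0 : ℝ) • v)).hasFDerivAt.comp_hasDerivAt _ hline
  have hpoly := (lineRestrict z v p).hasDerivAt 0
  simp only [eval_lineRestrict] at hpoly
  simpa using hpoly.unique hgrad

end PolynomialCalculus

section PolynomialBounds

variable {d m : ℕ} {p : MvPolynomial (Fin d) ℝ} {K : Set (Pt d)} {b z : Pt d} {σ M : ℝ}

theorem abs_inner_polyGrad_sub_le (hK : Convex ℝ K) (hp : p.totalDegree ≤ m)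
    (hM : ∀ z ∈ K, |polyEval z p| ≤ M) {y : Pt d} (hz : z ∈ K) (hy : y ∈ K) :
    |inner ℝ (polyGrad z p) (y - z)| ≤ 2 * (m : ℝ) ^ 2 * M := by
  simpa [derivative_lineRestrict_eval_zero] using
    mul_abs_derivative_eval_left_le (natDegree_lineRestrict_le z (y - z) hp) zero_le_one
      fun t ht => by
        rw [eval_lineRestrict]
        exact hM _ (hK.add_smul_sub_mem hz hy ht)

theorem mul_norm_polyGrad_le (hK : Convex ℝ K) (hσ : 0 ≤ σ) (hb : Metric.closedBall b σ ⊆ K)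
    (hp : p.totalDegree ≤ m) (hM : ∀ z ∈ K, |polyEval z p| ≤ M) (hz : z ∈ K) :
    σ * ‖polyGrad z p‖ ≤ 2 * (m : ℝ) ^ 2 * M := by
  have hM0 : 0 ≤ M := (abs_nonneg _).trans (hM z hz)
  rcases eq_or_ne (polyGrad z p) 0 with h0 | h0
  · rw [h0, norm_zero, mul_zero]
    positivity
  -- compare the two antipodal points of the ball in the direction of the gradient
  set v := (σ * ‖polyGrad z p‖⁻¹) • polyGrad z p
  have hv : ‖v‖ ≤ σ := by
    rw [norm_smul, norm_mul, norm_inv, norm_norm, mul_assoc,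
      inv_mul_cancel₀ (norm_ne_zero_iff.2 h0), mul_one, Real.norm_of_nonneg hσ]
  have hplus := abs_inner_polyGrad_sub_le hK hp hM hz (y := b + v) (hb (by simpa using hv))
  have hminus := abs_inner_polyGrad_sub_le hK hp hM hz (y := b - v)
    (hb (by simpa [mem_closedBall_iff_norm] using hv))
  have hinner : inner ℝ (polyGrad z p) v = σ * ‖polyGrad z p‖ := by
    rw [inner_smul_right, real_inner_self_eq_norm_sq]
    field_simp
  simp only [inner_sub_right, inner_add_right, hinner] at hplus hminus
  linarith [(abs_le.1 hplus).2, (abs_le.1 hminus).1]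

theorem mul_abs_polyEval_pderiv_le (hK : Convex ℝ K) (hσ : 0 ≤ σ)
    (hb : Metric.closedBall b σ ⊆ K) (hp : p.totalDegree ≤ m)
    (hM : ∀ z ∈ K, |polyEval z p| ≤ M) (hz : z ∈ K) (k : Fin d) :
    σ * |polyEval z (MvPolynomial.pderiv k p)| ≤ 2 * (m : ℝ) ^ 2 * M :=
  (mul_le_mul_of_nonneg_left (PiLp.norm_apply_le (polyGrad z p) k) hσ).trans
    (mul_norm_polyGrad_le hK hσ hb hp hM hz)

theorem sq_mul_abs_polyLaplacian_le (hK : Convex ℝ K) (hσ : 0 ≤ σ)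
    (hb : Metric.closedBall b σ ⊆ K) (hp : p.totalDegree ≤ m)
    (hM : ∀ z ∈ K, |polyEval z p| ≤ M) (hz : z ∈ K) :
    σ ^ 2 * |polyLaplacian z p| ≤ d * ((2 * (m : ℝ) ^ 2) ^ 2 * M) := by
  have hsecond (k : Fin d) :
      σ ^ 2 * |polyEval z (MvPolynomial.pderiv k (MvPolynomial.pderiv k p))|
        ≤ (2 * (m : ℝ) ^ 2) ^ 2 * M := by
    have h := mul_abs_polyEval_pderiv_le hK hσ hb (m := m)
      (p := MvPolynomial.C σ * MvPolynomial.pderiv k p)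
      (by
        rw [MvPolynomial.C_mul']
        exact (MvPolynomial.totalDegree_smul_le _ _).trans ((totalDegree_pderiv_le k p).trans hp))
      (fun w hw => by
        simpa [polyEval, abs_mul, abs_of_nonneg hσ] using
          mul_abs_polyEval_pderiv_le hK hσ hb hp hM hw k) hz k
    simp only [MvPolynomial.pderiv_C_mul, polyEval, map_mul, MvPolynomial.eval_C, abs_mul,
      abs_of_nonneg hσ] at h
    rw [polyEval]
    linarith
  calc σ ^ 2 * |polyLaplacian z p|
      ≤ σ ^ 2 * ∑ k, |polyEval z (MvPolynomial.pderiv k (MvPolynomial.pderiv k p))| := by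
        gcongr
        exact Finset.abs_sum_le_sum_abs _ _
    _ ≤ ∑ _k : Fin d, (2 * (m : ℝ) ^ 2) ^ 2 * M := by
        rw [Finset.mul_sum]
        exact Finset.sum_le_sum fun k _ => hsecond k
    _ = d * ((2 * (m : ℝ) ^ 2) ^ 2 * M) := by simp

theorem eq_zero_of_polyEval_eq_zero_on_closedBall (hσ : 0 < σ)
    (hp : ∀ z ∈ Metric.closedBall b σ, polyEval z p = 0) : p = 0 := by
  have hopen : IsOpen ((WithLp.toLp 2 : (Fin d → ℝ) → Pt d) ⁻¹' Metric.ball b σ) :=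
    Metric.isOpen_ball.preimage (PiLp.continuous_toLp 2 _)
  obtain ⟨ε, hε, hsub⟩ := Metric.isOpen_iff.1 hopen (WithLp.ofLp b) (by simpa using hσ)
  refine MvPolynomial.funext_set (fun k => Metric.ball (b k) ε) (fun k => ?_) fun x hx => ?_
  · rw [Real.ball_eq_Ioo]
    exact Set.Ioo_infinite (by linarith)
  · have hx' : x ∈ Metric.ball (WithLp.ofLp b) ε := by rwa [ball_pi _ hε]
    simpa [polyEval] using hp _ (Metric.ball_subset_closedBall (hsub hx'))

theorem exists_mem_closedBall_add_smul_sub_eq {E : Type*} [NormedAddCommGroup E]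
    [NormedSpace ℝ E] {z b y : E} {l σ : ℝ} (hl : 0 < l)
    (hy : dist (z + l • (b - z)) y ≤ l * σ) :
    ∃ w ∈ Metric.closedBall b σ, z + l • (w - z) = y := by
  refine ⟨z + l⁻¹ • (y - z), ?_, ?_⟩
  · have hw : b - (z + l⁻¹ • (y - z)) = l⁻¹ • (z + l • (b - z) - y) := by
      linear_combination (norm := module) -inv_smul_smul₀ hl.ne' (b - z)
    rw [mem_closedBall_iff_norm', hw, norm_smul, norm_inv, Real.norm_of_nonneg hl.le,
      inv_mul_le_iff₀ hl, ← dist_eq_norm]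
    exact hy
  · rw [add_sub_cancel_left, smul_smul, mul_inv_cancel₀ hl.ne', one_smul, add_sub_cancel]

/-- A sufficiently dense subset of a convex body is a norming set for polynomials: moving from a
maximum point of `|p|` towards the inscribed ball, one meets a point of `Y` at which, by Markov's
inequality, `|p|` is still at least half its maximum. -/
theorem abs_polyEval_le_two_mul_of_dense (hm : 0 < m) (hK : Convex ℝ K) (hKc : IsCompact K)
    (hb : Metric.closedBall b σ ⊆ K) {h : ℝ} (hh : 32 * (m : ℝ) ^ 2 * h ≤ 3 * σ) {Y : Set (Pt d)}
    (hY : ∀ z ∈ K, ∃ y ∈ Y, dist z y ≤ h) (hp : p.totalDegree ≤ m)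
    (hM : ∀ y ∈ Y, y ∈ K → |polyEval y p| ≤ M) (hσ : 0 ≤ σ) (hz : z ∈ K) :
    |polyEval z p| ≤ 2 * M := by
  obtain ⟨z₀, hz₀, hmax⟩ := hKc.exists_isMaxOn ⟨z, hz⟩
    (contDiff_polyEval p (n := 0)).continuous.abs.continuousOn
  have hm1 : (1 : ℝ) ≤ (m : ℝ) ^ 2 := one_le_pow₀ (by exact_mod_cast hm)
  set l : ℝ := 3 / (32 * (m : ℝ) ^ 2)
  have hl0 : 0 < l := by positivity
  have hlm : l * (32 * (m : ℝ) ^ 2) = 3 := div_mul_cancel₀ _ (by positivity)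
  have hl1 : l < 1 := by nlinarith
  obtain ⟨y, hyY, hy⟩ := hY _ (hK.add_smul_sub_mem hz₀ (hb (Metric.mem_closedBall_self hσ))
    ⟨hl0.le, hl1.le⟩)
  obtain ⟨w, hw, rfl⟩ := exists_mem_closedBall_add_smul_sub_eq hl0 (hy.trans
    (by nlinarith : h ≤ l * σ))
  have hyK := hK.add_smul_sub_mem hz₀ (hb hw) ⟨hl0.le, hl1.le⟩
  have hdrop : |polyEval (z₀ + l • (w - z₀)) p - polyEval z₀ p|
      ≤ 2 * (m : ℝ) ^ 2 * |polyEval z₀ p| / (1 - l) * l := by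
    simpa [eval_lineRestrict] using
      abs_eval_sub_eval_left_le (natDegree_lineRestrict_le z₀ (w - z₀) hp) (fun t ht => by
        rw [eval_lineRestrict]
        exact hmax (hK.add_smul_sub_mem hz₀ (hb hw) ht)) hl0.le hl1
  have hhalf : 2 * (m : ℝ) ^ 2 * |polyEval z₀ p| / (1 - l) * l ≤ 1 / 2 * |polyEval z₀ p| := by
    rw [div_mul_eq_mul_div, div_le_iff₀ (by linarith)]
    have hlA : 2 * (m : ℝ) ^ 2 * |polyEval z₀ p| * l = 3 / 16 * |polyEval z₀ p| := by
      linear_combination |polyEval z₀ p| / 16 * hlm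
    nlinarith [abs_nonneg (polyEval z₀ p)]
  have hmax_z : |polyEval z p| ≤ |polyEval z₀ p| := hmax hz
  have htri := abs_sub_abs_le_abs_sub (polyEval z₀ p) (polyEval (z₀ + l • (w - z₀)) p)
  rw [abs_sub_comm] at htri
  linarith [hM _ hyY hyK]

end PolynomialBounds

section SolidCone

variable {E : Type*} [NormedAddCommGroup E] [InnerProductSpace ℝ E] {a ξ z : E} {θ R t : ℝ}

/-- The truncated circular cone of `cone`, described by inequalities instead of by polar
coordinates; the inequalities make convexity and closedness evident. -/
def solidCone (a ξ : E) (θ R : ℝ) : Set E :=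
  {z | ‖z - a‖ ≤ R ∧ Real.cos θ * ‖z - a‖ ≤ inner ℝ (z - a) ξ}

theorem convex_solidCone (a ξ : E) (hθ : 0 ≤ Real.cos θ) (R : ℝ) :
    Convex ℝ (solidCone a ξ θ R) := by
  rintro x ⟨hx, hxξ⟩ y ⟨hy, hyξ⟩ s t hs ht hst
  have hdiff : s • x + t • y - a = s • (x - a) + t • (y - a) := by
    rw [smul_sub, smul_sub, sub_add_sub_comm, ← add_smul, hst, one_smul]
  have hnorm : ‖s • (x - a) + t • (y - a)‖ ≤ s * ‖x - a‖ + t * ‖y - a‖ := by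
    refine (norm_add_le _ _).trans_eq ?_
    rw [norm_smul, norm_smul, Real.norm_of_nonneg hs, Real.norm_of_nonneg ht]
  constructor
  · rw [hdiff]
    calc _ ≤ s * ‖x - a‖ + t * ‖y - a‖ := hnorm
      _ ≤ s * R + t * R := by gcongr
      _ = R := by rw [← add_mul, hst, one_mul]
  · rw [hdiff, inner_add_left, real_inner_smul_left, real_inner_smul_left]
    nlinarith [mul_le_mul_of_nonneg_left hnorm hθ]

theorem isCompact_solidCone [ProperSpace E] (a ξ : E) (θ R : ℝ) :
    IsCompact (solidCone a ξ θ R) := by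
  have hnorm : IsClosed {z : E | ‖z - a‖ ≤ R} := isClosed_le (by fun_prop) (by fun_prop)
  have hangle : IsClosed {z : E | Real.cos θ * ‖z - a‖ ≤ inner ℝ (z - a) ξ} :=
    isClosed_le (by fun_prop) (by fun_prop)
  exact (isCompact_closedBall a R).of_isClosed_subset (hnorm.inter hangle) fun z hz =>
    mem_closedBall_iff_norm.2 hz.1

theorem apex_mem_solidCone (hR : 0 ≤ R) : a ∈ solidCone a ξ θ R := by
  simp [solidCone, hR]

theorem add_smul_sub_mem_solidCone (ht : 0 ≤ t) (hz : z ∈ solidCone a ξ θ R) :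
    a + t • (z - a) ∈ solidCone a ξ θ (t * R) := by
  rw [solidCone, Set.mem_ofPred_eq, add_sub_cancel_left, norm_smul, Real.norm_of_nonneg ht,
    real_inner_smul_left, mul_left_comm]
  exact ⟨by gcongr; exact hz.1, by gcongr; exact hz.2⟩

theorem closedBall_subset_solidCone (hξ : ‖ξ‖ = 1) {ρ : ℝ} (hρ : 0 < ρ) :
    Metric.closedBall (a + ρ • ξ) (ρ * Real.sin θ) ⊆
      solidCone a ξ θ (ρ * (1 + Real.sin θ)) := by
  intro z hz
  obtain ⟨w, rfl⟩ : ∃ w, z = a + w := ⟨z - a, by abel⟩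
  rw [mem_closedBall_iff_norm, add_sub_add_left_eq_sub] at hz
  have hρξ : ‖ρ • ξ‖ = ρ := by rw [norm_smul, hξ, Real.norm_of_nonneg hρ.le, mul_one]
  rw [solidCone, Set.mem_ofPred_eq, add_sub_cancel_left]
  constructor
  · linarith [norm_le_norm_sub_add w (ρ • ξ)]
  · have hsq : ‖w - ρ • ξ‖ ^ 2 ≤ (ρ * Real.sin θ) ^ 2 := by gcongr
    rw [norm_sub_sq_real, inner_smul_right, hρξ, mul_pow, Real.sin_sq] at hsq
    refine le_of_mul_le_mul_left (a := 2 * ρ) ?_ (by positivity)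
    linarith [sq_nonneg (‖w‖ - ρ * Real.cos θ)]

end SolidCone

section ConeCondition

variable {d m N : ℕ} {Ω : Set (Pt d)} {r θ : ℝ} {a ξ : Pt d}

theorem solidCone_subset_cone (hξ : ‖ξ‖ = 1) {R : ℝ} (hR : R ≤ r) :
    solidCone a ξ θ R ⊆ cone a ξ θ r := by
  rintro z ⟨hz, hzξ⟩
  rcases eq_or_ne z a with rfl | hne
  · rw [sub_self, norm_zero] at hz
    exact ⟨ξ, 0, hξ, by simp [hξ, Real.cos_le_one], le_rfl, hz.trans hR, by simp⟩
  · have hpos : 0 < ‖z - a‖ := norm_pos_iff.2 (sub_ne_zero.2 hne)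
    refine ⟨‖z - a‖⁻¹ • (z - a), ‖z - a‖, ?_, ?_, hpos.le, hz.trans hR, ?_⟩
    · rw [norm_smul, norm_inv, norm_norm, inv_mul_cancel₀ hpos.ne']
    · rwa [real_inner_smul_left, inv_mul_eq_div, le_div_iff₀ hpos]
    · rw [smul_inv_smul₀ hpos.ne', add_sub_cancel]

theorem InteriorConeCondition.mem_closure_interior (hΩ : InteriorConeCondition Ω r θ)
    (hr : 0 < r) (hsin : 0 < Real.sin θ) (ha : a ∈ Ω) : a ∈ closure (interior Ω) := by
  obtain ⟨ξ, hξ, hcone⟩ := hΩ a ha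
  have htendsto : Filter.Tendsto (fun ρ : ℝ => a + ρ • ξ) (nhdsWithin 0 (Set.Ioi 0)) (nhds a) :=
    (Continuous.tendsto' (by fun_prop) 0 a (by simp)).mono_left nhdsWithin_le_nhds
  refine mem_closure_of_tendsto htendsto ?_
  have hr' : 0 < r / (1 + Real.sin θ) := by positivity
  filter_upwards [self_mem_nhdsWithin, mem_nhdsWithin_of_mem_nhds (gt_mem_nhds hr')]
    with ρ (hρ : 0 < ρ) hρr
  have hsub : Metric.closedBall (a + ρ • ξ) (ρ * Real.sin θ) ⊆ Ω :=
    (closedBall_subset_solidCone hξ hρ).trans <|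
      (solidCone_subset_cone hξ ((lt_div_iff₀ (by positivity)).1 hρr).le).trans hcone
  exact mem_interior_iff_mem_nhds.2 <|
    Filter.mem_of_superset (Metric.closedBall_mem_nhds _ (by positivity)) hsub

theorem InteriorConeCondition.infinite (hΩ : InteriorConeCondition Ω r θ)
    (hr : 0 < r) (hsin : 0 < Real.sin θ) (ha : a ∈ Ω) : Ω.Infinite := by
  obtain ⟨ξ, hξ, -⟩ := hΩ a ha
  have : Nontrivial (Pt d) := ⟨ξ, 0, norm_ne_zero_iff.1 (by simp [hξ])⟩
  obtain ⟨b, hb⟩ : (interior Ω).Nonempty :=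
    closure_nonempty_iff.1 ⟨a, hΩ.mem_closure_interior hr hsin ha⟩
  have := Module.punctured_nhds_neBot ℝ (Pt d) b
  exact infinite_of_mem_nhds b (mem_interior_iff_mem_nhds.1 hb)

theorem DomainCondition.sin_angle_pos (hΩ : DomainCondition Ω r θ) : 0 < Real.sin θ :=
  Real.sin_pos_of_pos_of_lt_pi hΩ.angle_pos (by linarith [hΩ.angle_lt, Real.pi_pos])

theorem DomainCondition.cos_angle_pos (hΩ : DomainCondition Ω r θ) : 0 < Real.cos θ :=
  Real.cos_pos_of_mem_Ioo ⟨by linarith [hΩ.angle_pos, Real.pi_pos], hΩ.angle_lt⟩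

theorem coneConst_pos (hm : 0 < m) (hsin : 0 < Real.sin θ) : 0 < coneConst m θ := by
  unfold coneConst
  positivity

theorem mul_sq_mul_one_add_sin_le (hsin : 0 < Real.sin θ) :
    32 * (m : ℝ) ^ 2 * (1 + Real.sin θ) ≤ 3 * (coneConst m θ * Real.sin θ) := by
  have hratio : 2 ≤ (1 + Real.sin θ) / Real.sin θ := by
    rw [le_div_iff₀ hsin]
    linarith [Real.sin_le_one θ]
  calc 32 * (m : ℝ) ^ 2 * (1 + Real.sin θ) = 16 * (m : ℝ) ^ 2 * (1 + Real.sin θ) * 2 := by ring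
    _ ≤ 16 * (m : ℝ) ^ 2 * (1 + Real.sin θ) * ((1 + Real.sin θ) / Real.sin θ) := by gcongr
    _ = 3 * (coneConst m θ * Real.sin θ) := by
      unfold coneConst
      field_simp

theorem edgeMid_eq_midpoint (x : Fin N → Pt d) (i j : Fin N) :
    edgeMid x i j = midpoint ℝ (x i) (x j) := by
  rw [edgeMid, midpoint_eq_smul_add, one_div, invOf_eq_inv]

theorem exists_midpoint_dist_le {x : Fin N → Pt d} {h R : ℝ} {z : Pt d}
    (hx : ∀ z ∈ Ω, ∃ j, dist z (x j) ≤ h) (hΩ : solidCone a ξ θ (2 * R) ⊆ Ω)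
    (hz : z ∈ solidCone a ξ θ R) : ∃ j, dist z (midpoint ℝ a (x j)) ≤ h / 2 := by
  obtain ⟨j, hj⟩ := hx _ (hΩ (add_smul_sub_mem_solidCone zero_le_two hz))
  refine ⟨j, ?_⟩
  have hmid : midpoint ℝ a (a + (2 : ℝ) • (z - a)) = z := by
    rw [midpoint_eq_smul_add, invOf_eq_inv]
    module
  have h := dist_midpoint_midpoint_le a (a + (2 : ℝ) • (z - a)) a (x j)
  rw [hmid, dist_self, zero_add] at h
  linarith

/-- The cone `K` has half the radius `coneConst m θ * h`: doubling it about `a` takes the midpoints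
of the edges to their endpoints and stays inside `Ω`. -/
theorem InteriorConeCondition.exists_norming_cone (hΩ : InteriorConeCondition Ω r θ)
    (hm : 0 < m) (hsin : 0 < Real.sin θ) (hcos : 0 ≤ Real.cos θ) {x : Fin N → Pt d} {h : ℝ}
    (hh : 0 < h) (hhr : coneConst m θ * h ≤ r) (hx : ∀ z ∈ Ω, ∃ j, dist z (x j) ≤ h)
    (ha : a ∈ Ω) :
    ∃ (K : Set (Pt d)) (b : Pt d), Convex ℝ K ∧ a ∈ K ∧
      Metric.closedBall b (2 * (m : ℝ) ^ 2 * h) ⊆ K ∧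
      ∀ p : MvPolynomial (Fin d) ℝ, p.totalDegree ≤ m → ∀ M : ℝ,
        (∀ j, ‖x j - a‖ ≤ coneConst m θ * h → |polyEval (midpoint ℝ a (x j)) p| ≤ M) →
        ∀ z ∈ K, |polyEval z p| ≤ 2 * M := by
  obtain ⟨ξ, hξ, hcone⟩ := hΩ a ha
  have hR : 0 < coneConst m θ * h := mul_pos (coneConst_pos hm hsin) hh
  set ρ := coneConst m θ * h / 2 / (1 + Real.sin θ)
  have hρ : 0 < ρ := by positivity
  have hρR : ρ * (1 + Real.sin θ) = coneConst m θ * h / 2 := div_mul_cancel₀ _ (by positivity)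
  have hball := closedBall_subset_solidCone (a := a) (θ := θ) hξ hρ
  rw [hρR] at hball
  have hσ : 16 * (m : ℝ) ^ 2 * h ≤ 3 * (ρ * Real.sin θ) := by
    refine le_of_mul_le_mul_right ?_ (by positivity : 0 < 1 + Real.sin θ)
    have hconst := mul_le_mul_of_nonneg_right (mul_sq_mul_one_add_sin_le (m := m) hsin) hh.le
    linear_combination hconst / 2 - 3 * Real.sin θ * hρR
  refine ⟨solidCone a ξ θ (coneConst m θ * h / 2), a + ρ • ξ, convex_solidCone a ξ hcos _,
    apex_mem_solidCone (by positivity),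
    (Metric.closedBall_subset_closedBall (by nlinarith [sq_nonneg (m : ℝ)])).trans hball,
    fun p hp M hM z hz => ?_⟩
  refine abs_polyEval_le_two_mul_of_dense (h := h / 2) (Y := Set.range fun j => midpoint ℝ a (x j))
    hm (convex_solidCone a ξ hcos _) (isCompact_solidCone a ξ θ _) hball (by linarith)
    (fun y hy => ?_) hp ?_ (by positivity) hz
  · obtain ⟨j, hj⟩ := exists_midpoint_dist_le hx
      ((solidCone_subset_cone hξ (by linarith)).trans hcone) hy
    exact ⟨_, ⟨j, rfl⟩, hj⟩
  · rintro _ ⟨j, rfl⟩ hj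
    refine hM j ?_
    have hnorm := hj.1
    rw [midpoint_sub_left, norm_smul, invOf_eq_inv, norm_inv, Real.norm_two] at hnorm
    linarith

end ConeCondition

section Nodes

variable {d m N : ℕ} {Ω : Set (Pt d)} {x : Fin N → Pt d} {Φ : ℝ → ℝ} {ε : ℝ} {i : Fin N}

theorem exists_dist_le_fillDistance (hΩ : IsCompact Ω) (i : Fin N) {z : Pt d} (hz : z ∈ Ω) :
    ∃ j, dist z (x j) ≤ fillDistance x Ω := by
  obtain ⟨_, ⟨j, rfl⟩, hj⟩ := (Set.finite_range x).isCompact.exists_infDist_eq_dist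
    ⟨x i, i, rfl⟩ z
  exact ⟨j, hj ▸ le_csSup (hΩ.image (Metric.continuous_infDist_pt _)).bddAbove ⟨z, hz, rfl⟩⟩

theorem fillDistance_pos (hΩ : IsCompact Ω) (hinf : Ω.Infinite) (i : Fin N) :
    0 < fillDistance x Ω := by
  by_contra! hle
  refine hinf ((Set.finite_range x).subset fun z hz => ?_)
  obtain ⟨j, hj⟩ := exists_dist_le_fillDistance hΩ i hz
  exact ⟨j, (dist_le_zero.1 (hj.trans hle)).symm⟩

theorem separationDistance_nonneg (x : Fin N → Pt d) : 0 ≤ separationDistance x :=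
  div_nonneg (Real.sInf_nonneg (by rintro _ ⟨i, j, -, rfl⟩; exact dist_nonneg)) zero_le_two

theorem two_mul_separationDistance_le_dist (x : Fin N → Pt d) {i j : Fin N} (hij : i ≠ j) :
    2 * separationDistance x ≤ dist (x i) (x j) := by
  rw [separationDistance, mul_div_cancel₀ _ two_ne_zero]
  exact csInf_le ⟨0, by rintro _ ⟨i, j, -, rfl⟩; exact dist_nonneg⟩ ⟨i, j, hij, rfl⟩

theorem exists_card_le_of_separated (E : Type*) [NormedAddCommGroup E] [NormedSpace ℝ E]
    [ProperSpace E] (B : ℝ) :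
    ∃ n : ℕ, ∀ {ι : Type} (s : Finset ι) (y : ι → E) (a : E) (t : ℝ), 0 < t →
      (∀ j ∈ s, ‖y j - a‖ ≤ B * t) →
      (∀ j ∈ s, ∀ k ∈ s, j ≠ k → t ≤ dist (y j) (y k)) → s.card ≤ n := by
  obtain ⟨T, hT, hcover⟩ := Metric.totallyBounded_iff.1
    (isCompact_closedBall (0 : E) B).totallyBounded (1 / 2) (by norm_num)
  refine ⟨hT.toFinset.card, fun {ι} s y a t ht hB hsep => ?_⟩
  have hmem : ∀ j ∈ s, ∃ c ∈ T, dist (t⁻¹ • (y j - a)) c < 1 / 2 := by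
    intro j hj
    have hball : t⁻¹ • (y j - a) ∈ Metric.closedBall (0 : E) B := by
      rw [mem_closedBall_zero_iff, norm_smul, norm_inv, Real.norm_of_nonneg ht.le,
        inv_mul_le_iff₀ ht, mul_comm]
      exact hB j hj
    simpa using hcover hball
  choose! f hfT hf using hmem
  refine Finset.card_le_card_of_injOn f (fun j hj => by simpa using hfT j hj) ?_
  intro j hj k hk hjk
  by_contra hne
  have htri := dist_triangle_right (t⁻¹ • (y j - a)) (t⁻¹ • (y k - a)) (f j)
  rw [dist_smul₀, dist_sub_right, norm_inv, Real.norm_of_nonneg ht.le] at htri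
  have hsep' : 1 ≤ t⁻¹ * dist (y j) (y k) := by
    rw [inv_mul_eq_div, one_le_div ht]
    exact hsep j hj k hk hne
  linarith [hf j hj, hjk ▸ hf k hk]

theorem exists_card_nbr_le (d : ℕ) {B : ℝ} (hB : 0 ≤ B) (c : ℝ) :
    ∃ n : ℕ, ∀ {N : ℕ} (x : Fin N → Pt d) (i : Fin N) (ε h : ℝ), 0 < h →
      h ≤ c * separationDistance x →
        (Finset.univ.filter fun j : Nbr x ε i => ‖x j - x i‖ ≤ B * h).card ≤ n := by
  obtain ⟨n, hn⟩ := exists_card_le_of_separated (Pt d) (B * c / 2)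
  refine ⟨n, fun x i ε h hh hhc => hn _ (fun j => x j) (x i) (2 * separationDistance x) ?_
    (fun j hj => ?_) fun j _ k _ hjk =>
      two_mul_separationDistance_le_dist x (Subtype.coe_ne_coe.2 hjk)⟩
  · have hne : separationDistance x ≠ 0 := fun h0 => by simp [h0, hh.not_ge] at hhc
    exact mul_pos two_pos ((separationDistance_nonneg x).lt_of_ne' hne)
  · calc ‖x j - x i‖ ≤ B * h := (Finset.mem_filter.1 hj).2
      _ ≤ B * (c * separationDistance x) := by gcongr
      _ = B * c / 2 * (2 * separationDistance x) := by ring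

theorem norm_sub_edgeMid (x : Fin N → Pt d) (i j : Fin N) :
    ‖x i - edgeMid x i j‖ = ‖x j - x i‖ / 2 := by
  rw [edgeMid_eq_midpoint, ← dist_eq_norm, dist_left_midpoint, Real.norm_two, dist_eq_norm',
    inv_mul_eq_div]

/-- Two-sided bounds for a radial weight of support radius `δ`. All weights of one fixed profile
satisfy them with the same `w` and `W`, which is the only way in which the profile matters. -/
structure WeightBounds (Φ : ℝ → ℝ) (δ w W : ℝ) : Prop where
  nonneg : ∀ s, 0 ≤ s → 0 ≤ Φ s
  le : ∀ s, 0 ≤ s → Φ s ≤ W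
  support : ∀ s, δ < s → Φ s = 0
  ge : ∀ s, 0 ≤ s → s ≤ δ / 4 → w ≤ Φ s

theorem WeightCondition.profile {ψ : ℝ → ℝ} {δ : ℝ} (hδ : 0 < δ) (hΦ : WeightCondition Φ δ)
    (hψ : ∀ s, 0 ≤ s → Φ s = ψ (s / δ)) : WeightCondition ψ 1 := by
  have hψΦ : ∀ t, 0 ≤ t → ψ t = Φ (δ * t) := fun t ht => by
    rw [hψ _ (by positivity), mul_div_cancel_left₀ _ hδ.ne']
  refine ⟨?_, fun s hs => ?_, fun s hs => ?_, fun s hs hs' => ?_⟩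
  · exact (hΦ.cont.comp (f := fun t => δ * t) (by fun_prop) fun t ht =>
      mul_nonneg hδ.le ht).congr fun t ht => hψΦ t ht
  · rw [hψΦ s hs]
    exact hΦ.nonneg _ (by positivity)
  · rw [hψΦ s (by linarith)]
    exact hΦ.support _ (by nlinarith)
  · rw [hψΦ s hs]
    exact hΦ.pos _ (by positivity) (by nlinarith)

theorem WeightCondition.exists_weightBounds {δ : ℝ} (hδ : 0 < δ) (hΦ : WeightCondition Φ δ) :
    ∃ w W : ℝ, 0 < w ∧ WeightBounds Φ δ w W := by
  obtain ⟨s₀, hs₀, hmin⟩ := (isCompact_Icc (a := 0) (b := δ / 4)).exists_isMinOn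
    ⟨0, Set.left_mem_Icc.2 (by positivity)⟩ (hΦ.cont.mono fun s hs => hs.1)
  obtain ⟨s₁, hs₁, hmax⟩ := (isCompact_Icc (a := 0) (b := δ)).exists_isMaxOn
    ⟨0, by simp [hδ.le]⟩ (hΦ.cont.mono fun s hs => hs.1)
  refine ⟨Φ s₀, Φ s₁, hΦ.pos _ hs₀.1 (by linarith [hs₀.2]), hΦ.nonneg, fun s hs => ?_,
    hΦ.support, fun s hs hs' => hmin ⟨hs, hs'⟩⟩
  rcases le_or_gt s δ with hsδ | hsδ
  · exact hmax ⟨hs, hsδ⟩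
  · rw [hΦ.support s hsδ]
    exact hΦ.nonneg _ hs₁.1

theorem exists_weightBounds_of_profile (ψ : ℝ → ℝ) :
    ∃ w W : ℝ, 0 < w ∧ ∀ (δ : ℝ) (Φ : ℝ → ℝ), 0 < δ → WeightCondition Φ δ →
      (∀ s, 0 ≤ s → Φ s = ψ (s / δ)) → WeightBounds Φ δ w W := by
  by_cases hψ : WeightCondition ψ 1
  · obtain ⟨w, W, hw, hbd⟩ := hψ.exists_weightBounds one_pos
    refine ⟨w, W, hw, fun δ Φ hδ hΦ hΦψ => ⟨hΦ.nonneg, fun s hs => ?_, hΦ.support,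
      fun s hs hs' => ?_⟩⟩
    · rw [hΦψ s hs]
      exact hbd.le _ (by positivity)
    · rw [hΦψ s hs]
      refine hbd.ge _ (by positivity) ?_
      rw [div_le_iff₀ hδ]
      linarith
  · exact ⟨1, 1, one_pos, fun δ Φ hδ hΦ hΦψ => absurd (hΦ.profile hδ hΦψ) hψ⟩

end Nodes

section LeastSquares

variable {d m N : ℕ} {Φ : ℝ → ℝ} {x : Fin N → Pt d} {ε : ℝ} {i : Fin N} {u : EdgeSpace x ε i}
  {p q : MvPolynomial (Fin d) ℝ}

/-- `vanishingPoly m a` as a linear subspace of the polynomials. -/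
def vanishingSubmodule (m : ℕ) (a : Pt d) : Submodule ℝ (MvPolynomial (Fin d) ℝ) where
  carrier := vanishingPoly m a
  add_mem' {p q} hp hq := ⟨(MvPolynomial.totalDegree_add _ _).trans (max_le hp.1 hq.1), by
    have hpa := hp.2
    have hqa := hq.2
    simp_all [polyEval]⟩
  zero_mem' := ⟨by simp, by simp [polyEval]⟩
  smul_mem' t p hp := ⟨(MvPolynomial.totalDegree_smul_le _ _).trans hp.1, by
    have hpa := hp.2
    simp_all [polyEval]⟩

/-- The values of a polynomial at the edge midpoints, scaled by the square roots of the weights: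
this makes `lsqFunctional` a squared Euclidean distance. -/
def weightedValues (Φ : ℝ → ℝ) (x : Fin N → Pt d) (ε : ℝ) (i : Fin N) :
    MvPolynomial (Fin d) ℝ →ₗ[ℝ] EuclideanSpace ℝ (Nbr x ε i) where
  toFun p := WithLp.toLp 2 fun j => √(Φ ‖x i - edgeMid x i j‖) * polyEval (edgeMid x i j) p
  map_add' p q := by ext j; simp [polyEval, mul_add]
  map_smul' t p := by ext j; simp [polyEval, mul_left_comm]

theorem lsqFunctional_eq_dist_sq (hΦ : ∀ s, 0 ≤ s → 0 ≤ Φ s) (u : EdgeSpace x ε i)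
    (p : MvPolynomial (Fin d) ℝ) :
    lsqFunctional Φ x ε i u p = dist
      (WithLp.toLp 2 fun j : Nbr x ε i => √(Φ ‖x i - edgeMid x i j‖) * u j)
      (weightedValues Φ x ε i p) ^ 2 := by
  rw [EuclideanSpace.dist_eq, Real.sq_sqrt (Finset.sum_nonneg fun _ _ => sq_nonneg _),
    lsqFunctional]
  refine Finset.sum_congr rfl fun j _ => ?_
  simp only [weightedValues, LinearMap.coe_mk, AddHom.coe_mk]
  rw [Real.dist_eq, sq_abs, ← mul_sub, mul_pow, Real.sq_sqrt (hΦ _ (norm_nonneg _)), mul_comm]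

theorem exists_isFit (hΦ : ∀ s, 0 ≤ s → 0 ≤ Φ s) (u : EdgeSpace x ε i) :
    ∃ p, IsFit m Φ x ε i u p := by
  obtain ⟨_, ⟨p, hp, rfl⟩, hmin⟩ := ((vanishingSubmodule m (x i)).map
      (weightedValues Φ x ε i)).closed_of_finiteDimensional.exists_infDist_eq_dist
    ⟨0, Submodule.zero_mem _⟩ (WithLp.toLp 2 fun j : Nbr x ε i => √(Φ ‖x i - edgeMid x i j‖) * u j)
  refine ⟨p, hp, fun q hq => ?_⟩
  rw [Set.mem_ofPred_eq, lsqFunctional_eq_dist_sq hΦ, lsqFunctional_eq_dist_sq hΦ, ← hmin]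
  gcongr
  · exact Metric.infDist_nonneg
  · exact Metric.infDist_le_dist_of_mem ⟨q, hq, rfl⟩

theorem isFit_gmlsFit (hΦ : ∀ s, 0 ≤ s → 0 ≤ Φ s) (u : EdgeSpace x ε i) :
    IsFit m Φ x ε i u (gmlsFit m Φ x ε i u) := by
  have hfit := exists_isFit (m := m) hΦ u
  rw [gmlsFit, dif_pos hfit]
  exact hfit.choose_spec

theorem lsqFunctional_parallelogram (u : EdgeSpace x ε i) (p q : MvPolynomial (Fin d) ℝ) :
    lsqFunctional Φ x ε i 0 (p - q) + 4 * lsqFunctional Φ x ε i u ((1 / 2 : ℝ) • (p + q))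
      = 2 * (lsqFunctional Φ x ε i u p + lsqFunctional Φ x ε i u q) := by
  simp only [lsqFunctional, mul_add, Finset.mul_sum, ← Finset.sum_add_distrib]
  refine Finset.sum_congr rfl fun j _ => ?_
  simp only [polyEval, map_sub, MvPolynomial.smul_eval, map_add, Pi.zero_apply]
  ring

theorem IsFit.lsqFunctional_sub_le (hp : IsFit m Φ x ε i u p) (hq : q ∈ vanishingPoly m (x i)) :
    lsqFunctional Φ x ε i 0 (p - q)
      ≤ 2 * (lsqFunctional Φ x ε i u q - lsqFunctional Φ x ε i u p) := by
  have hmid : lsqFunctional Φ x ε i u p ≤ lsqFunctional Φ x ε i u ((1 / 2 : ℝ) • (p + q)) :=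
    hp.2 ((vanishingSubmodule m (x i)).smul_mem _ ((vanishingSubmodule m (x i)).add_mem hp.1 hq))
  linarith [lsqFunctional_parallelogram (Φ := Φ) u p q]

theorem lsqFunctional_nonneg (hΦ : ∀ s, 0 ≤ s → 0 ≤ Φ s) : 0 ≤ lsqFunctional Φ x ε i u p :=
  Finset.sum_nonneg fun _ _ => mul_nonneg (sq_nonneg _) (hΦ _ (norm_nonneg _))

theorem WeightBounds.lsqFunctional_le {δ w W η : ℝ} {n : ℕ} (hΦ : WeightBounds Φ δ w W)
    (hη : ∀ j : Nbr x ε i, ‖x j - x i‖ ≤ 2 * δ → |u j - polyEval (edgeMid x i j) p| ≤ η)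
    (hn : (Finset.univ.filter fun j : Nbr x ε i => ‖x j - x i‖ ≤ 2 * δ).card ≤ n) :
    lsqFunctional Φ x ε i u p ≤ n * (η ^ 2 * W) := by
  have hW : 0 ≤ W := (hΦ.nonneg 0 le_rfl).trans (hΦ.le 0 le_rfl)
  set s := Finset.univ.filter fun j : Nbr x ε i => ‖x j - x i‖ ≤ 2 * δ
  calc lsqFunctional Φ x ε i u p
      = ∑ j ∈ s, (u j - polyEval (edgeMid x i j) p) ^ 2 * Φ ‖x i - edgeMid x i j‖ := by
        refine (Finset.sum_subset (Finset.subset_univ s) fun j _ hj => ?_).symm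
        have hfar : δ < ‖x i - edgeMid x i j‖ := by
          rw [norm_sub_edgeMid]
          linarith [not_le.1 fun hle => hj (Finset.mem_filter.2 ⟨Finset.mem_univ j, hle⟩)]
        rw [hΦ.support _ hfar, mul_zero]
    _ ≤ ∑ _j ∈ s, η ^ 2 * W := Finset.sum_le_sum fun j hj => by
        have hsq := sq_le_sq' (neg_le_of_abs_le (hη j (Finset.mem_filter.1 hj).2))
          (le_of_abs_le (hη j (Finset.mem_filter.1 hj).2))
        exact mul_le_mul hsq (hΦ.le _ (norm_nonneg _)) (hΦ.nonneg _ (norm_nonneg _)) (sq_nonneg η)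
    _ = s.card * (η ^ 2 * W) := by rw [Finset.sum_const, nsmul_eq_mul]
    _ ≤ n * (η ^ 2 * W) := by gcongr

theorem WeightBounds.abs_polyEval_edgeMid_le {δ w W B : ℝ} (hΦ : WeightBounds Φ δ w W)
    (hw : 0 < w) (hB : 0 ≤ B) (hp : lsqFunctional Φ x ε i 0 p ≤ w * B ^ 2) {j : Fin N}
    (hjε : ‖x j - x i‖ < ε) (hjδ : ‖x j - x i‖ ≤ δ / 2) : |polyEval (edgeMid x i j) p| ≤ B := by
  have hterm : polyEval (edgeMid x i j) p ^ 2 * Φ ‖x i - edgeMid x i j‖ ≤ w * B ^ 2 := by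
    refine le_trans ?_ hp
    simpa [lsqFunctional] using Finset.single_le_sum
      (f := fun j : Nbr x ε i => ((0 : EdgeSpace x ε i) j - polyEval (edgeMid x i j) p) ^ 2
        * Φ ‖x i - edgeMid x i j‖)
      (fun k _ => mul_nonneg (sq_nonneg _) (hΦ.nonneg _ (norm_nonneg _)))
      (Finset.mem_univ (⟨j, hjε⟩ : Nbr x ε i))
  have hwj : w ≤ Φ ‖x i - edgeMid x i j‖ := by
    refine hΦ.ge _ (norm_nonneg _) ?_
    rw [norm_sub_edgeMid]
    linarith
  refine abs_le_of_sq_le_sq (le_of_mul_le_mul_left ?_ hw) hB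
  calc _ ≤ Φ ‖x i - edgeMid x i j‖ * polyEval (edgeMid x i j) p ^ 2 := by gcongr
    _ ≤ w * B ^ 2 := by rwa [mul_comm]

end LeastSquares

section Symmetry

variable {E F : Type*} [NormedAddCommGroup E] [NormedSpace ℝ E]
  [NormedAddCommGroup F] [NormedSpace ℝ F] {f : E → F} {k : ℕ} {z : E}

theorem iteratedFDeriv_succ_succ_apply (f : E → F) (k : ℕ) (z : E) (v : Fin (k + 2) → E) :
    iteratedFDeriv ℝ (k + 2) f z v
      = fderiv ℝ (fderiv ℝ (iteratedFDeriv ℝ k f)) z (v 0) (v 1) (Fin.tail (Fin.tail v)) := by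
  have hcurry := LinearIsometryEquiv.comp_fderiv (𝕜 := ℝ) (E := E →L[ℝ] E [×k]→L[ℝ] F)
    (F := E [×(k + 1)]→L[ℝ] F) (f := fderiv ℝ (iteratedFDeriv ℝ k f)) (x := z)
    (continuousMultilinearCurryLeftEquiv ℝ (fun _ : Fin (k + 1) => E) F).symm
  rw [iteratedFDeriv_succ_apply_left, iteratedFDeriv_succ_eq_comp_left]
  exact DFunLike.congr_fun (DFunLike.congr_fun hcurry (v 0)) (Fin.tail v)

theorem iteratedFDeriv_comp_swap_zero_one (hf : ContDiffAt ℝ ((k + 2 : ℕ) : WithTop ℕ∞) f z)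
    (v : Fin (k + 2) → E) :
    iteratedFDeriv ℝ (k + 2) f z (v ∘ Equiv.swap 0 1) = iteratedFDeriv ℝ (k + 2) f z v := by
  have hsymm : IsSymmSndFDerivAt ℝ (iteratedFDeriv ℝ k f) z :=
    (hf.iteratedFDeriv_right (m := 2) (by norm_cast; omega)).isSymmSndFDerivAt (by simp)
  have htail : Fin.tail (Fin.tail (v ∘ Equiv.swap 0 1)) = Fin.tail (Fin.tail v) := by
    funext j
    simp [Fin.tail, Equiv.swap_apply_of_ne_of_ne, Fin.ext_iff]
  rw [iteratedFDeriv_succ_succ_apply, iteratedFDeriv_succ_succ_apply, htail, ← hsymm.eq]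
  simp

theorem iteratedFDeriv_succ_apply_congr_tail {u v : Fin k → E} (w : E)
    (huv : ∀ᶠ y in nhds z, iteratedFDeriv ℝ k f y u = iteratedFDeriv ℝ k f y v)
    (hf : DifferentiableAt ℝ (iteratedFDeriv ℝ k f) z) :
    iteratedFDeriv ℝ (k + 1) f z (Fin.cons w u) = iteratedFDeriv ℝ (k + 1) f z (Fin.cons w v) := by
  have hstep : ∀ u : Fin k → E, iteratedFDeriv ℝ (k + 1) f z (Fin.cons w u)
      = fderiv ℝ (fun y => iteratedFDeriv ℝ k f y u) z w := fun u => by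
    rw [iteratedFDeriv_succ_apply_left, (hf.hasFDerivAt.continuousMultilinear_apply_const u).fderiv]
    rfl
  rw [hstep, hstep, Filter.EventuallyEq.fderiv_eq huv]

theorem iteratedFDeriv_comp_swap_castSucc_succ
    (hf : ContDiffAt ℝ ((k + 1 : ℕ) : WithTop ℕ∞) f z) (i : Fin k) (v : Fin (k + 1) → E) :
    iteratedFDeriv ℝ (k + 1) f z (v ∘ Equiv.swap i.castSucc i.succ)
      = iteratedFDeriv ℝ (k + 1) f z v := by
  induction k generalizing z with
  | zero => exact i.elim0
  | succ k ih =>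
    induction i using Fin.cases with
    | zero => exact iteratedFDeriv_comp_swap_zero_one hf v
    | succ i =>
      have hcons : v ∘ Equiv.swap i.succ.castSucc i.succ.succ
          = Fin.cons (v 0) (Fin.tail v ∘ Equiv.swap i.castSucc i.succ) := by
        funext j
        induction j using Fin.cases with
        | zero => simp [Equiv.swap_apply_of_ne_of_ne, Fin.ext_iff]
        | succ j =>
          simp only [Function.comp, Fin.cons_succ, Fin.tail, ← Fin.succ_castSucc]
          rw [(Fin.succ_injective _).swap_apply]
      rw [hcons, ← Fin.cons_self_tail v]
      refine iteratedFDeriv_succ_apply_congr_tail _ ?_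
        (hf.differentiableAt_iteratedFDeriv (by exact_mod_cast Nat.lt_succ_self _))
      filter_upwards [hf.eventually (by simp)] with y hy
      exact ih (hy.of_le (by exact_mod_cast Nat.le_succ _)) i _

theorem iteratedFDeriv_comp_equiv (hf : ContDiffAt ℝ (k : WithTop ℕ∞) f z)
    (σ : Equiv.Perm (Fin k)) (v : Fin k → E) :
    iteratedFDeriv ℝ k f z (v ∘ σ) = iteratedFDeriv ℝ k f z v := by
  cases k with
  | zero => rw [Subsingleton.elim (v ∘ σ) v]
  | succ k =>
    have hσ : σ ∈ Submonoid.closure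
        (Set.range fun i : Fin k => Equiv.swap i.castSucc i.succ) := by
      rw [Equiv.Perm.mclosure_swap_castSucc_succ]
      exact Submonoid.mem_top σ
    induction hσ using Submonoid.closure_induction generalizing v with
    | mem τ hτ =>
      obtain ⟨i, rfl⟩ := hτ
      exact iteratedFDeriv_comp_swap_castSucc_succ hf i v
    | one => rfl
    | mul τ τ' _ _ hτ hτ' =>
      rw [Equiv.Perm.coe_mul, ← Function.comp_assoc, hτ', hτ]

theorem iteratedFDerivWithin_comp_equiv {S : Set E} {a : E}
    (hf : ContDiffOn ℝ (k : WithTop ℕ∞) f S) (hS : UniqueDiffOn ℝ S)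
    (ha : a ∈ S) (ha' : a ∈ closure (interior S)) (σ : Equiv.Perm (Fin k)) (v : Fin k → E) :
    iteratedFDerivWithin ℝ k f S a (v ∘ σ) = iteratedFDerivWithin ℝ k f S a v := by
  have hinterior : Set.EqOn (fun z => iteratedFDerivWithin ℝ k f S z (v ∘ σ))
      (fun z => iteratedFDerivWithin ℝ k f S z v) (interior S) := fun z hz => by
    have hfz : ContDiffAt ℝ (k : WithTop ℕ∞) f z := hf.contDiffAt (mem_interior_iff_mem_nhds.1 hz)
    simp only [iteratedFDerivWithin_eq_iteratedFDeriv hS hfz (interior_subset hz)]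
    exact iteratedFDeriv_comp_equiv hfz σ v
  have hcont : ∀ u : Fin k → E, ContinuousOn (fun z => iteratedFDerivWithin ℝ k f S z u) S :=
    fun u => (ContinuousMultilinearMap.apply ℝ (fun _ => E) F u).continuous.comp_continuousOn
      (hf.continuousOn_iteratedFDerivWithin le_rfl hS)
  exact hinterior.of_subset_closure (t := S ∩ closure (interior S))
    ((hcont _).mono Set.inter_subset_left) ((hcont _).mono Set.inter_subset_left)
    (Set.subset_inter interior_subset subset_closure) Set.inter_subset_right ⟨ha, ha'⟩

end Symmetry

section FinitePowerSeries

variable {E F : Type*} [NormedAddCommGroup E] [NormedSpace ℝ E]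
  [NormedAddCommGroup F] [NormedSpace ℝ F] {f : E → F} {p : FormalMultilinearSeries ℝ E F}
  {a : E} {n k : ℕ}

theorem hasFiniteFPowerSeriesOnBall_partialSum (a : E) (hp : ∀ k, n ≤ k → p k = 0) :
    HasFiniteFPowerSeriesOnBall (fun z => p.partialSum n (z - a)) p a n ⊤ :=
  .mk' hp ENNReal.zero_lt_top fun y _ => by rw [add_sub_cancel_left]; rfl

theorem contDiff_of_hasFiniteFPowerSeriesOnBall (hf : HasFiniteFPowerSeriesOnBall f p a n ⊤)
    {r : WithTop ℕ∞} : ContDiff ℝ r f :=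
  contDiff_iff_contDiffAt.2 fun z => (hf.cpolynomialAt_of_mem (by simp)).contDiffAt

theorem iteratedFDeriv_eq_factorial_smul (hf : HasFiniteFPowerSeriesOnBall f p a n ⊤)
    (hsymm : ∀ (σ : Equiv.Perm (Fin k)) v, p k (v ∘ σ) = p k v) :
    iteratedFDeriv ℝ k f a = k.factorial • p k := by
  ext v
  rw [hf.toHasFPowerSeriesOnBall.iteratedFDeriv_eq_sum fun z _ =>
    (hf.cpolynomialAt_of_mem (by simp)).analyticAt.analyticWithinAt]
  exact (Finset.sum_congr rfl fun σ _ => hsymm σ v).trans (by simp [Fintype.card_perm])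

theorem iteratedFDeriv_eq_zero_of_le (hf : HasFiniteFPowerSeriesOnBall f p a n ⊤) (hnk : n ≤ k)
    (z : E) : iteratedFDeriv ℝ k f z = 0 := by
  have hz := hf.changeOrigin (y := z - a) ENNReal.coe_lt_top
  rw [ENNReal.top_sub_coe, add_sub_cancel] at hz
  rw [iteratedFDeriv_eq_factorial_smul hz (by simp [hz.finite k hnk]), hz.finite k hnk, smul_zero]

end FinitePowerSeries

section SeriesPolynomial

variable {d : ℕ} (p : FormalMultilinearSeries ℝ (Pt d) ℝ) (n : ℕ) (a : Pt d)

/-- The partial sum `∑ k < n, p k (z - a, …, z - a)` as a polynomial in the coordinates of `z`. -/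
def seriesPoly : MvPolynomial (Fin d) ℝ :=
  ∑ k ∈ Finset.range n, ∑ s : Fin k → Fin d,
    MvPolynomial.C (p k fun i => EuclideanSpace.single (s i) 1) *
      ∏ i, (MvPolynomial.X (s i) - MvPolynomial.C (a (s i)))

theorem polyEval_seriesPoly (z : Pt d) :
    polyEval z (seriesPoly p n a) = p.partialSum n (z - a) := by
  have hbasis : z - a = ∑ l, (z l - a l) • EuclideanSpace.single l (1 : ℝ) := by
    ext l
    simp [Pi.single_apply]
  simp only [polyEval, seriesPoly, FormalMultilinearSeries.partialSum, map_sum, map_mul, map_prod,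
    map_sub, MvPolynomial.eval_C, MvPolynomial.eval_X]
  refine Finset.sum_congr rfl fun k _ => ?_
  rw [hbasis, (p k).map_sum]
  refine Finset.sum_congr rfl fun s _ => ?_
  rw [(p k).map_smul_univ (fun i => z (s i) - a (s i)), smul_eq_mul, mul_comm]

theorem totalDegree_seriesPoly_succ_le : (seriesPoly p (n + 1) a).totalDegree ≤ n := by
  refine MvPolynomial.totalDegree_finsetSum_le fun k hk =>
    MvPolynomial.totalDegree_finsetSum_le fun s _ => ?_
  calc _ ≤ 0 + ∑ _i : Fin k, 1 := by
        refine (MvPolynomial.totalDegree_mul _ _).trans (add_le_add (by simp)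
          ((MvPolynomial.totalDegree_finsetProd _ _).trans (Finset.sum_le_sum fun i _ => ?_)))
        exact (MvPolynomial.totalDegree_sub_C_le _ _).trans (MvPolynomial.totalDegree_X _).le
    _ ≤ n := by simpa using Finset.mem_range_succ_iff.1 hk

end SeriesPolynomial

section Taylor

variable {E F : Type*} [NormedAddCommGroup E] [NormedSpace ℝ E]
  [NormedAddCommGroup F] [NormedSpace ℝ F] {m k : ℕ} {f : E → F} {S : Set E} {a : E}

/-- The Taylor series at `a` of a function on `S`, truncated after the terms of order `m`. -/
def taylorSeriesWithin (m : ℕ) (f : E → F) (S : Set E) (a : E) : FormalMultilinearSeries ℝ E F :=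
  fun k => if k ≤ m then (k.factorial : ℝ)⁻¹ • iteratedFDerivWithin ℝ k f S a else 0

/-- The Taylor polynomial of order `m` at `a` of a function on `S`. -/
def taylorPolyWithin (m : ℕ) (f : E → F) (S : Set E) (a z : E) : F :=
  (taylorSeriesWithin m f S a).partialSum (m + 1) (z - a)

/-- The power series at `a` of `w ↦ T (a + 2 (w - a)) - T a`, where `T` is the Taylor polynomial of
order `m` of `f` at `a`: its value at the midpoint of `a` and `z` is `T z - T a`. -/
def midTaylorSeries (m : ℕ) (f : E → F) (S : Set E) (a : E) : FormalMultilinearSeries ℝ E F :=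
  fun k => if k = 0 then 0 else (2 : ℝ) ^ k • taylorSeriesWithin m f S a k

theorem taylorSeriesWithin_eq_zero (hk : m + 1 ≤ k) : taylorSeriesWithin m f S a k = 0 :=
  if_neg (by omega)

theorem midTaylorSeries_eq_zero (hk : m + 1 ≤ k) : midTaylorSeries m f S a k = 0 := by
  rw [midTaylorSeries, taylorSeriesWithin_eq_zero hk, smul_zero, ite_self]

theorem taylorSeriesWithin_comp_equiv (hf : ContDiffOn ℝ (m : WithTop ℕ∞) f S)
    (hS : UniqueDiffOn ℝ S) (ha : a ∈ S) (ha' : a ∈ closure (interior S))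
    (σ : Equiv.Perm (Fin k)) (v : Fin k → E) :
    taylorSeriesWithin m f S a k (v ∘ σ) = taylorSeriesWithin m f S a k v := by
  unfold taylorSeriesWithin
  split_ifs with hk
  · simp only [_root_.smul_apply]
    rw [iteratedFDerivWithin_comp_equiv (hf.of_le (by exact_mod_cast hk)) hS ha ha']
  · rfl

theorem factorial_smul_taylorSeriesWithin (hk : k ≤ m) :
    k.factorial • taylorSeriesWithin m f S a k = iteratedFDerivWithin ℝ k f S a := by
  rw [taylorSeriesWithin, if_pos hk, ← Nat.cast_smul_eq_nsmul ℝ, smul_smul,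
    mul_inv_cancel₀ (by exact_mod_cast k.factorial_ne_zero), one_smul]

theorem contDiff_taylorPolyWithin {r : WithTop ℕ∞} : ContDiff ℝ r (taylorPolyWithin m f S a) :=
  contDiff_of_hasFiniteFPowerSeriesOnBall
    (hasFiniteFPowerSeriesOnBall_partialSum a fun _ => taylorSeriesWithin_eq_zero)

theorem iteratedFDeriv_taylorPolyWithin_center (hf : ContDiffOn ℝ (m : WithTop ℕ∞) f S)
    (hS : UniqueDiffOn ℝ S) (ha : a ∈ S) (ha' : a ∈ closure (interior S)) (hk : k ≤ m) :
    iteratedFDeriv ℝ k (taylorPolyWithin m f S a) a = iteratedFDerivWithin ℝ k f S a := by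
  rw [← factorial_smul_taylorSeriesWithin hk]
  exact iteratedFDeriv_eq_factorial_smul
    (hasFiniteFPowerSeriesOnBall_partialSum a fun _ => taylorSeriesWithin_eq_zero)
    (taylorSeriesWithin_comp_equiv hf hS ha ha')

theorem iteratedFDeriv_taylorPolyWithin_of_lt (hk : m < k) (z : E) :
    iteratedFDeriv ℝ k (taylorPolyWithin m f S a) z = 0 :=
  iteratedFDeriv_eq_zero_of_le
    (hasFiniteFPowerSeriesOnBall_partialSum a fun _ => taylorSeriesWithin_eq_zero) hk z

theorem taylorSeriesWithin_zero_apply (v : Fin 0 → E) : taylorSeriesWithin m f S a 0 v = f a := by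
  simp [taylorSeriesWithin]

theorem partialSum_midTaylorSeries (m : ℕ) (f : E → F) (S : Set E) (a z : E) :
    (midTaylorSeries m f S a).partialSum (m + 1) (midpoint ℝ a z - a)
      = taylorPolyWithin m f S a z - f a := by
  rw [taylorPolyWithin, FormalMultilinearSeries.partialSum, FormalMultilinearSeries.partialSum,
    Finset.sum_range_succ', Finset.sum_range_succ', taylorSeriesWithin_zero_apply,
    add_sub_cancel_right, midTaylorSeries, if_pos rfl, _root_.zero_apply, add_zero]
  refine Finset.sum_congr rfl fun k _ => ?_
  have hdouble : z - a = (2 : ℝ) • (midpoint ℝ a z - a) := by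
    rw [midpoint_sub_left, smul_smul]
    simp
  rw [hdouble, (taylorSeriesWithin m f S a (k + 1)).map_smul_univ fun _ => (2 : ℝ)]
  simp [midTaylorSeries]

end Taylor

section MidTaylor

variable {d m : ℕ} {φ : Pt d → ℝ} {S : Set (Pt d)} {a : Pt d}

/-- The polynomial whose value at the midpoint of `a` and `z` is the increment from `a` to `z` of
the Taylor polynomial of `φ` at `a`. -/
def midTaylor (m : ℕ) (φ : Pt d → ℝ) (S : Set (Pt d)) (a : Pt d) : MvPolynomial (Fin d) ℝ :=
  seriesPoly (midTaylorSeries m φ S a) (m + 1) a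

theorem polyEval_midpoint_midTaylor (m : ℕ) (φ : Pt d → ℝ) (S : Set (Pt d)) (a z : Pt d) :
    polyEval (midpoint ℝ a z) (midTaylor m φ S a) = taylorPolyWithin m φ S a z - φ a := by
  rw [midTaylor, polyEval_seriesPoly, partialSum_midTaylorSeries]

theorem midTaylor_mem_vanishingPoly (m : ℕ) (φ : Pt d → ℝ) (S : Set (Pt d)) (a : Pt d) :
    midTaylor m φ S a ∈ vanishingPoly m a := by
  refine ⟨totalDegree_seriesPoly_succ_le _ _ _, ?_⟩
  rw [midTaylor, polyEval_seriesPoly, sub_self, FormalMultilinearSeries.partialSum,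
    Finset.sum_range_succ', Finset.sum_eq_zero fun k _ => ?_]
  · simp [midTaylorSeries]
  · exact ContinuousMultilinearMap.map_coord_zero _ 0 rfl

theorem hasFiniteFPowerSeriesOnBall_midTaylor (m : ℕ) (φ : Pt d → ℝ) (S : Set (Pt d)) (a : Pt d) :
    HasFiniteFPowerSeriesOnBall (fun z => polyEval z (midTaylor m φ S a))
      (midTaylorSeries m φ S a) a (m + 1) ⊤ := by
  simp only [midTaylor, polyEval_seriesPoly]
  exact hasFiniteFPowerSeriesOnBall_partialSum a fun _ => midTaylorSeries_eq_zero

theorem iteratedFDeriv_midTaylor (hφ : ContDiffOn ℝ (m : WithTop ℕ∞) φ S)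
    (hS : UniqueDiffOn ℝ S) (ha : a ∈ S) (ha' : a ∈ closure (interior S)) {k : ℕ} (hk : k ≠ 0)
    (hkm : k ≤ m) :
    iteratedFDeriv ℝ k (fun z => polyEval z (midTaylor m φ S a)) a
      = (2 : ℝ) ^ k • iteratedFDerivWithin ℝ k φ S a := by
  have hseries : midTaylorSeries m φ S a k = (2 : ℝ) ^ k • taylorSeriesWithin m φ S a k :=
    if_neg hk
  rw [iteratedFDeriv_eq_factorial_smul (hasFiniteFPowerSeriesOnBall_midTaylor m φ S a), hseries,
    smul_comm, factorial_smul_taylorSeriesWithin hkm]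
  intro σ v
  simp only [hseries, _root_.smul_apply,
    taylorSeriesWithin_comp_equiv hφ hS ha ha' σ v]

theorem polyGrad_midTaylor (hm : m ≠ 0) (hφ : ContDiffOn ℝ (m : WithTop ℕ∞) φ S)
    (hS : UniqueDiffOn ℝ S) (ha : a ∈ S) (ha' : a ∈ closure (interior S)) :
    polyGrad a (midTaylor m φ S a) = (2 : ℝ) • gradientWithin φ S a := by
  rw [← gradient_polyEval]
  refine ext_inner_right ℝ fun v => ?_
  have hderiv := DFunLike.congr_fun
    (iteratedFDeriv_midTaylor hφ hS ha ha' one_ne_zero (Nat.one_le_iff_ne_zero.2 hm)) fun _ => v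
  simpa [iteratedFDerivWithin_one_apply (hS a ha), inner_smul_left, inner_gradient_left,
    inner_gradientWithin_left] using hderiv

theorem abs_laplacianWithin_le (hS : UniqueDiffOn ℝ S) (ha : a ∈ S) :
    |InnerProductSpace.laplacianWithin φ S a| ≤ d * ‖iteratedFDerivWithin ℝ 2 φ S a‖ := by
  rw [InnerProductSpace.laplacianWithin_eq_iteratedFDerivWithin_orthonormalBasis φ hS ha
    (EuclideanSpace.basisFun (Fin d) ℝ)]
  refine (Finset.abs_sum_le_sum_abs _ _).trans
    ((Finset.sum_le_card_nsmul _ _ ‖iteratedFDerivWithin ℝ 2 φ S a‖ fun k _ => ?_).trans_eq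
      (by simp))
  rw [← Real.norm_eq_abs]
  exact (ContinuousMultilinearMap.le_opNorm _ _).trans_eq (by simp)

theorem polyLaplacian_midTaylor (hm : 2 ≤ m) (hφ : ContDiffOn ℝ (m : WithTop ℕ∞) φ S)
    (hS : UniqueDiffOn ℝ S) (ha : a ∈ S) (ha' : a ∈ closure (interior S)) :
    polyLaplacian a (midTaylor m φ S a) = 4 * InnerProductSpace.laplacianWithin φ S a := by
  rw [← laplacian_polyEval, InnerProductSpace.laplacian_eq_iteratedFDeriv_orthonormalBasis _
    (EuclideanSpace.basisFun (Fin d) ℝ),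
    InnerProductSpace.laplacianWithin_eq_iteratedFDerivWithin_orthonormalBasis φ hS ha
    (EuclideanSpace.basisFun (Fin d) ℝ), Finset.mul_sum]
  simp only [iteratedFDeriv_midTaylor hφ hS ha ha' two_ne_zero hm]
  refine Finset.sum_congr rfl fun k _ => ?_
  rw [_root_.smul_apply, smul_eq_mul]
  norm_num

theorem polyLaplacian_midTaylor_one (φ : Pt d → ℝ) (S : Set (Pt d)) (a : Pt d) :
    polyLaplacian a (midTaylor 1 φ S a) = 0 := by
  rw [← laplacian_polyEval, InnerProductSpace.laplacian_eq_iteratedFDeriv_orthonormalBasis _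
    (EuclideanSpace.basisFun (Fin d) ℝ)]
  simp only [iteratedFDeriv_eq_zero_of_le (hasFiniteFPowerSeriesOnBall_midTaylor 1 φ S a) le_rfl]
  simp

end MidTaylor

section CurveTaylor

variable {E F : Type*} [NormedAddCommGroup E] [NormedSpace ℝ E]
  [NormedAddCommGroup F] [NormedSpace ℝ F] {f : E → F} {S : Set E} {γ : ℝ → E} {L : NNReal}
  {B t : ℝ} {m n : ℕ}

theorem eventually_norm_comp_sub_le {f' : E →L[ℝ] F} (hf : HasFDerivWithinAt f f' S (γ t))
    (hγS : Set.MapsTo γ (Set.Icc 0 1) S) (hγ : LipschitzOnWith L γ (Set.Icc 0 1))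
    (ht : t ∈ Set.Ico (0 : ℝ) 1) {η : ℝ} (hη : 0 < η) :
    ∀ᶠ u in nhdsWithin t (Set.Ioi t), ‖f (γ u) - f (γ t)‖ ≤ (‖f'‖ * L + η) * (u - t) := by
  have ht' : t ∈ Set.Icc (0 : ℝ) 1 := Set.Ico_subset_Icc_self ht
  have hIcc : ∀ᶠ u in nhdsWithin t (Set.Ioi t), u ∈ Set.Icc (0 : ℝ) 1 :=
    Filter.mem_of_superset (Ioo_mem_nhdsGT ht.2) fun u hu => ⟨ht.1.trans hu.1.le, hu.2.le⟩
  have htendsto : Filter.Tendsto γ (nhdsWithin t (Set.Ioi t)) (nhdsWithin (γ t) S) :=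
    tendsto_nhdsWithin_iff.2 ⟨(hγ.continuousOn t ht').tendsto.mono_left
      (le_inf nhdsWithin_le_nhds (Filter.le_principal_iff.2 hIcc)), hIcc.mono hγS⟩
  have hlip : ∀ᶠ u in nhdsWithin t (Set.Ioi t), ‖γ u - γ t‖ ≤ L * ‖u - t‖ := by
    filter_upwards [hIcc] with u hu
    simpa only [dist_eq_norm] using hγ.dist_le_mul u hu t ht'
  have hsmall := ((hasFDerivWithinAt_iff_isLittleO.1 hf).comp_tendsto htendsto).trans_isBigO
    (Asymptotics.IsBigO.of_bound L hlip)
  filter_upwards [hsmall.def hη, hlip, self_mem_nhdsWithin] with u herr hu htu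
  rw [Real.norm_of_nonneg (sub_pos.2 htu).le] at herr hu
  calc ‖f (γ u) - f (γ t)‖
      = ‖(f (γ u) - f (γ t) - f' (γ u - γ t)) + f' (γ u - γ t)‖ := by rw [sub_add_cancel]
    _ ≤ η * (u - t) + ‖f'‖ * (L * (u - t)) :=
        (norm_add_le _ _).trans (add_le_add herr (f'.le_opNorm_of_le hu))
    _ = _ := by ring

theorem norm_comp_sub_le_of_norm_fderivWithin_le (hf : DifferentiableOn ℝ f S)
    (hγS : Set.MapsTo γ (Set.Icc 0 1) S) (hγ : LipschitzOnWith L γ (Set.Icc 0 1))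
    (hB : ∀ s ∈ Set.Icc (0 : ℝ) 1, ‖fderivWithin ℝ f S (γ s)‖ ≤ B)
    (ht : t ∈ Set.Icc (0 : ℝ) 1) : ‖f (γ t) - f (γ 0)‖ ≤ B * L * t := by
  refine image_le_of_liminf_slope_right_le_deriv_boundary
    (f := fun s => ‖f (γ s) - f (γ 0)‖) (B' := fun _ => B * L)
    ((hf.continuousOn.comp hγ.continuousOn hγS).sub continuousOn_const).norm (by simp)
    (by fun_prop) (fun s _ => ?_) (fun s hs r hr => ?_) ht
  · simpa using ((hasDerivAt_id s).const_mul (B * (L : ℝ))).hasDerivWithinAt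
  · have hs' : s ∈ Set.Icc (0 : ℝ) 1 := Set.Ico_subset_Icc_self hs
    have hgap : 0 < (r - B * L) / 2 := half_pos (sub_pos.2 hr)
    refine Filter.Eventually.frequently ?_
    filter_upwards [eventually_norm_comp_sub_le (hf _ (hγS hs')).hasFDerivWithinAt hγS hγ hs hgap,
      self_mem_nhdsWithin] with u hu hsu
    have hsu' : 0 < u - s := sub_pos.2 hsu
    rw [slope_def_field, div_lt_iff₀ hsu']
    calc ‖f (γ u) - f (γ 0)‖ - ‖f (γ s) - f (γ 0)‖ ≤ ‖f (γ u) - f (γ s)‖ := by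
          simpa using norm_sub_norm_le (f (γ u) - f (γ 0)) (f (γ s) - f (γ 0))
      _ ≤ (‖fderivWithin ℝ f S (γ s)‖ * L + (r - B * L) / 2) * (u - s) := hu
      _ ≤ (B * L + (r - B * L) / 2) * (u - s) := by gcongr; exact hB s hs'
      _ < r * (u - s) := by gcongr; linarith

theorem norm_comp_le_of_iteratedFDerivWithin_eq_zero (hf : ContDiffOn ℝ (n : WithTop ℕ∞) f S)
    (hS : UniqueDiffOn ℝ S) (hγS : Set.MapsTo γ (Set.Icc 0 1) S)
    (hγ : LipschitzOnWith L γ (Set.Icc 0 1))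
    (hB : ∀ z ∈ S, ‖iteratedFDerivWithin ℝ n f S z‖ ≤ B)
    (hzero : ∀ k < n, iteratedFDerivWithin ℝ k f S (γ 0) = 0) (ht : t ∈ Set.Icc (0 : ℝ) 1) :
    ‖f (γ t)‖ ≤ B * L ^ n := by
  have hderiv : ∀ j k, k + j = n → ∀ s ∈ Set.Icc (0 : ℝ) 1,
      ‖iteratedFDerivWithin ℝ k f S (γ s)‖ ≤ B * L ^ j := by
    intro j
    induction j with
    | zero => rintro k rfl s hs; simpa using hB _ (hγS hs)
    | succ j ih =>
      intro k hk s hs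
      have hB' : 0 ≤ B * L ^ j :=
        (norm_nonneg _).trans (ih (k + 1) (by omega) s hs)
      have hmvt := norm_comp_sub_le_of_norm_fderivWithin_le
        (hf.differentiableOn_iteratedFDerivWithin (m := k) (by norm_cast; omega) hS) hγS hγ
        (fun u hu => norm_fderivWithin_iteratedFDerivWithin.trans_le
          (ih (k + 1) (by omega) u hu)) hs
      rw [hzero k (by omega), sub_zero] at hmvt
      calc _ ≤ B * L ^ j * L * s := hmvt
        _ ≤ B * L ^ j * L * 1 := by gcongr; exact hs.2
        _ = B * L ^ (j + 1) := by ring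
  simpa using hderiv n 0 (zero_add n) t ht

theorem norm_sub_taylorPolyWithin_le (hf : ContDiffOn ℝ ((m + 1 : ℕ) : WithTop ℕ∞) f S)
    (hS : UniqueDiffOn ℝ S) (hγS : Set.MapsTo γ (Set.Icc 0 1) S)
    (hγ : LipschitzOnWith L γ (Set.Icc 0 1)) (hγ₀ : γ 0 ∈ closure (interior S))
    (hB : ∀ z ∈ S, ‖iteratedFDerivWithin ℝ (m + 1) f S z‖ ≤ B) (ht : t ∈ Set.Icc (0 : ℝ) 1) :
    ‖f (γ t) - taylorPolyWithin m f S (γ 0) (γ t)‖ ≤ B * L ^ (m + 1) := by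
  have hderiv : ∀ k ≤ m + 1, ∀ z ∈ S,
      iteratedFDerivWithin ℝ k (fun z => f z - taylorPolyWithin m f S (γ 0) z) S z
        = iteratedFDerivWithin ℝ k f S z - iteratedFDeriv ℝ k (taylorPolyWithin m f S (γ 0)) z := by
    intro k hk z hz
    rw [← iteratedFDerivWithin_eq_iteratedFDeriv hS contDiff_taylorPolyWithin.contDiffAt hz]
    exact iteratedFDerivWithin_sub_apply ((hf z hz).of_le (by exact_mod_cast hk))
      contDiff_taylorPolyWithin.contDiffWithinAt hS hz
  have h₀ : γ 0 ∈ S := hγS (by simp)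
  refine norm_comp_le_of_iteratedFDerivWithin_eq_zero
    (f := fun z => f z - taylorPolyWithin m f S (γ 0) z)
    (hf.sub contDiff_taylorPolyWithin.contDiffOn) hS hγS hγ (fun z hz => ?_) (fun k hk => ?_) ht
  · rw [hderiv _ le_rfl z hz, iteratedFDeriv_taylorPolyWithin_of_lt m.lt_succ_self, sub_zero]
    exact hB z hz
  · rw [hderiv k hk.le _ h₀, iteratedFDeriv_taylorPolyWithin_center
      (hf.of_le (by exact_mod_cast m.le_succ)) hS h₀ hγ₀ (Nat.lt_succ_iff.1 hk), sub_self]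

theorem norm_taylorPolyWithin_le {a : E} (hB : ∀ k ≤ m, ‖iteratedFDerivWithin ℝ k f S a‖ ≤ B)
    (z : E) : ‖taylorPolyWithin m f S a z‖ ≤ B * ∑ k ∈ Finset.range (m + 1), ‖z - a‖ ^ k := by
  rw [Finset.mul_sum]
  refine norm_sum_le_of_le (Finset.range (m + 1)) fun k hk => ?_
  have hkm : k ≤ m := Finset.mem_range_succ_iff.1 hk
  have hfact : ((k.factorial : ℝ))⁻¹ ≤ 1 :=
    inv_le_one_of_one_le₀ (by exact_mod_cast k.factorial_pos)
  rw [taylorSeriesWithin, if_pos hkm, _root_.smul_apply, norm_smul, norm_inv, RCLike.norm_natCast]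
  calc _ ≤ 1 * ‖iteratedFDerivWithin ℝ k f S a fun _ => z - a‖ := by gcongr
    _ ≤ ‖iteratedFDerivWithin ℝ k f S a‖ * ‖z - a‖ ^ k := by
        simpa using (iteratedFDerivWithin ℝ k f S a).le_opNorm fun _ => z - a
    _ ≤ B * ‖z - a‖ ^ k := by gcongr; exact hB k hkm

end CurveTaylor

section CkNorm

variable {d m n k : ℕ} {Ω S : Set (Pt d)} {φ : Pt d → ℝ}

theorem norm_iteratedFDerivWithin_le_ckNorm (hc : IsCompact S) (hS : UniqueDiffOn ℝ S)
    (hφ : ContDiffOn ℝ (n : WithTop ℕ∞) φ S) (hk : k ≤ n) {z : Pt d} (hz : z ∈ S) :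
    ‖iteratedFDerivWithin ℝ k φ S z‖ ≤ ckNorm n S φ := by
  have hbdd : BddAbove (⋃ k ∈ Set.Iic n, (fun z => ‖iteratedFDerivWithin ℝ k φ S z‖) '' S) :=
    (Set.finite_Iic n).bddAbove_biUnion.2 fun k hk => (hc.image_of_continuousOn
      (hφ.continuousOn_iteratedFDerivWithin (by exact_mod_cast hk) hS).norm).bddAbove
  refine le_csSup (hbdd.mono ?_) ⟨k, hk, z, hz, rfl⟩
  rintro _ ⟨l, hl, y, hy, rfl⟩
  exact Set.mem_biUnion hl ⟨y, hy, rfl⟩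

theorem ckNorm_nonneg (n : ℕ) (S : Set (Pt d)) (φ : Pt d → ℝ) : 0 ≤ ckNorm n S φ :=
  Real.sSup_nonneg (by rintro _ ⟨k, _, z, _, rfl⟩; exact norm_nonneg _)

theorem abs_sub_taylorPolyWithin_le (hc : IsCompact S) (hS : UniqueDiffOn ℝ S)
    (hφ : ContDiffOn ℝ (n : WithTop ℕ∞) φ S) (hmn : m ≤ n) {a z : Pt d} (ha : a ∈ S)
    (hz : z ∈ S) :
    |φ z - taylorPolyWithin m φ S a z|
      ≤ (1 + ∑ k ∈ Finset.range (m + 1), dist a z ^ k) * ckNorm n S φ := by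
  have hvalue : |φ z| ≤ ckNorm n S φ := by
    simpa using norm_iteratedFDerivWithin_le_ckNorm hc hS hφ n.zero_le hz
  have htaylor := norm_taylorPolyWithin_le
    (fun k hk => norm_iteratedFDerivWithin_le_ckNorm hc hS hφ (hk.trans hmn) ha) z
  rw [Real.norm_eq_abs, ← dist_eq_norm'] at htaylor
  calc _ ≤ |φ z| + |taylorPolyWithin m φ S a z| := abs_sub _ _
    _ ≤ _ := by linarith

theorem abs_sub_taylorPolyWithin_le_of_joined {κ ρ : ℝ} (hjoin : JoinedByShortCurves Ω S κ ρ)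
    (hc : IsCompact S) (hS : UniqueDiffOn ℝ S)
    (hφ : ContDiffOn ℝ ((m + 1 : ℕ) : WithTop ℕ∞) φ S) {a z : Pt d} (ha : a ∈ Ω) (hz : z ∈ Ω)
    (haS : a ∈ closure (interior S)) (haz : dist a z ≤ ρ) :
    |φ z - taylorPolyWithin m φ S a z| ≤ ckNorm (m + 1) S φ * (|κ| * dist a z) ^ (m + 1) := by
  obtain ⟨γ, rfl, rfl, hγS, hγ⟩ := hjoin a ha z hz haz
  have hlip : LipschitzOnWith ⟨|κ| * dist (γ 0) (γ 1), by positivity⟩ γ (Set.Icc 0 1) :=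
    .of_dist_le_mul fun s hs t ht => (hγ s hs t ht).trans <|
      mul_le_mul_of_nonneg_right
        (mul_le_mul_of_nonneg_right (le_abs_self κ) dist_nonneg) (abs_nonneg _)
  exact norm_sub_taylorPolyWithin_le hφ hS hγS hlip haS
    (fun z hz => norm_iteratedFDerivWithin_le_ckNorm hc hS hφ le_rfl hz)
    (Set.right_mem_Icc.2 zero_le_one)

theorem RegularityRegion.exists_taylor_bound (m : ℕ) (hS : RegularityRegion Ω S)
    (hΩ : IsCompact Ω) (hint : Ω ⊆ closure (interior Ω)) :
    ∃ A : ℝ, 0 ≤ A ∧ ∀ φ : Pt d → ℝ, ContDiffOn ℝ ((m + 1 : ℕ) : WithTop ℕ∞) φ S →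
      ∀ a ∈ Ω, ∀ z ∈ Ω, |φ z - taylorPolyWithin m φ S a z|
        ≤ A * ckNorm (m + 1) S φ * dist a z ^ (m + 1) := by
  obtain ⟨κ, ρ, hρ, hjoin⟩ := hS.joined
  set Λ : ℝ := 1 + ∑ k ∈ Finset.range (m + 1), Metric.diam Ω ^ k
  have : 0 ≤ Λ := by positivity
  refine ⟨max (|κ| ^ (m + 1)) (Λ / ρ ^ (m + 1)), by positivity, fun φ hφ a ha z hz => ?_⟩
  have hck := ckNorm_nonneg (m + 1) S φ
  rcases le_or_gt (dist a z) ρ with hnear | hfar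
  · calc _ ≤ ckNorm (m + 1) S φ * (|κ| * dist a z) ^ (m + 1) :=
          abs_sub_taylorPolyWithin_le_of_joined hjoin hS.compact hS.uniqueDiff hφ ha hz
            (closure_mono (interior_mono hS.subset) (hint ha)) hnear
      _ = |κ| ^ (m + 1) * ckNorm (m + 1) S φ * dist a z ^ (m + 1) := by ring
      _ ≤ _ := by gcongr; exact le_max_left _ _
  · have hdiam : dist a z ≤ Metric.diam Ω := Metric.dist_le_diam_of_mem hΩ.isBounded ha hz
    calc _ ≤ (1 + ∑ k ∈ Finset.range (m + 1), dist a z ^ k) * ckNorm (m + 1) S φ :=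
          abs_sub_taylorPolyWithin_le hS.compact hS.uniqueDiff hφ m.le_succ (hS.subset ha)
            (hS.subset hz)
      _ ≤ Λ * ckNorm (m + 1) S φ := by simp only [Λ]; gcongr
      _ = Λ / ρ ^ (m + 1) * ckNorm (m + 1) S φ * ρ ^ (m + 1) := by field_simp
      _ ≤ _ := by gcongr; exact le_max_right _ _

end CkNorm

section Stability

variable {d m N : ℕ} {Ω : Set (Pt d)} {r θ : ℝ} {Φ : ℝ → ℝ} {x : Fin N → Pt d} {ε : ℝ}
  {i : Fin N} {h w W B : ℝ} {u : EdgeSpace x ε i} {p q : MvPolynomial (Fin d) ℝ}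

/-- Stability at the length scale `h` of the least-squares fit at `x i`: the squares of the values
at the edge midpoints, summed with the weight `Φ`, control the polynomials of degree at most `m`.
The number `w` normalizes the weight. -/
structure StableFit (m : ℕ) (Φ : ℝ → ℝ) (x : Fin N → Pt d) (ε : ℝ) (i : Fin N) (h w : ℝ) :
    Prop where
  mul_norm_polyGrad_le : ∀ p : MvPolynomial (Fin d) ℝ, p.totalDegree ≤ m → ∀ B, 0 ≤ B →
    lsqFunctional Φ x ε i 0 p ≤ w * B ^ 2 → h * ‖polyGrad (x i) p‖ ≤ 2 * B
  sq_mul_abs_polyLaplacian_le : ∀ p : MvPolynomial (Fin d) ℝ, p.totalDegree ≤ m → ∀ B, 0 ≤ B →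
    lsqFunctional Φ x ε i 0 p ≤ w * B ^ 2 → h ^ 2 * |polyLaplacian (x i) p| ≤ d * (2 * B)
  eq_zero : ∀ p : MvPolynomial (Fin d) ℝ, p.totalDegree ≤ m →
    lsqFunctional Φ x ε i 0 p ≤ 0 → p = 0

theorem WeightBounds.stableFit (hΦ : WeightBounds Φ (2 * coneConst m θ * h) w W) (hw : 0 < w)
    (hΩ : DomainCondition Ω r θ) (hm : 0 < m) (hh : 0 < h) (hhr : coneConst m θ * h ≤ r)
    (hx : ∀ z ∈ Ω, ∃ j, dist z (x j) ≤ h) (hi : x i ∈ Ω) (hε : coneConst m θ * h < ε) :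
    StableFit m Φ x ε i h w := by
  obtain ⟨K, b, hK, hiK, hb, hnorm⟩ := hΩ.cone_condition.exists_norming_cone hm hΩ.sin_angle_pos
    hΩ.cos_angle_pos.le hh hhr hx hi
  have hσ : 0 < 2 * (m : ℝ) ^ 2 * h := by positivity
  have hvalue : ∀ p : MvPolynomial (Fin d) ℝ, p.totalDegree ≤ m → ∀ B, 0 ≤ B →
      lsqFunctional Φ x ε i 0 p ≤ w * B ^ 2 → ∀ z ∈ K, |polyEval z p| ≤ 2 * B :=
    fun p hp B hB hlsq => hnorm p hp B fun j hj => by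
      rw [← edgeMid_eq_midpoint]
      exact hΦ.abs_polyEval_edgeMid_le hw hB hlsq (hj.trans_lt hε) (by linarith)
  refine ⟨fun p hp B hB hlsq => ?_, fun p hp B hB hlsq => ?_, fun p hp hlsq => ?_⟩
  · refine le_of_mul_le_mul_left ?_ (by positivity : 0 < 2 * (m : ℝ) ^ 2)
    rw [← mul_assoc]
    exact StaggeredGMLS.mul_norm_polyGrad_le hK hσ.le hb hp (hvalue p hp B hB hlsq) hiK
  · refine le_of_mul_le_mul_left ?_ (by positivity : 0 < (2 * (m : ℝ) ^ 2) ^ 2)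
    rw [← mul_assoc, ← mul_pow, mul_left_comm]
    exact StaggeredGMLS.sq_mul_abs_polyLaplacian_le hK hσ.le hb hp (hvalue p hp B hB hlsq) hiK
  · refine eq_zero_of_polyEval_eq_zero_on_closedBall (b := b) hσ fun z hz => abs_nonpos_iff.1 ?_
    simpa using hvalue p hp 0 le_rfl (by simpa using hlsq) z (hb hz)

theorem StableFit.existsUnique_isFit (hst : StableFit m Φ x ε i h w)
    (hΦ : ∀ s, 0 ≤ s → 0 ≤ Φ s) (u : EdgeSpace x ε i) : ∃! p, IsFit m Φ x ε i u p := by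
  obtain ⟨p, hp⟩ := exists_isFit (m := m) hΦ u
  refine ⟨p, hp, fun q hq => sub_eq_zero.1 (hst.eq_zero _
    ((vanishingSubmodule m (x i)).sub_mem hq.1 hp.1).1 ?_)⟩
  linarith [hq.lsqFunctional_sub_le hp.1, show lsqFunctional Φ x ε i u p ≤ _ from hp.2 hq.1]

theorem lsqFunctional_gmlsFit_sub_le (hΦ : ∀ s, 0 ≤ s → 0 ≤ Φ s)
    (hq : q ∈ vanishingPoly m (x i)) :
    lsqFunctional Φ x ε i 0 (gmlsFit m Φ x ε i u - q) ≤ 2 * lsqFunctional Φ x ε i u q := by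
  linarith [(isFit_gmlsFit hΦ u).lsqFunctional_sub_le hq,
    lsqFunctional_nonneg hΦ (p := gmlsFit m Φ x ε i u) (u := u)]

theorem totalDegree_gmlsFit_sub_le (hΦ : ∀ s, 0 ≤ s → 0 ≤ Φ s) (u : EdgeSpace x ε i)
    (hq : q ∈ vanishingPoly m (x i)) : (gmlsFit m Φ x ε i u - q).totalDegree ≤ m :=
  ((vanishingSubmodule m (x i)).sub_mem (isFit_gmlsFit hΦ u).1 hq).1

theorem StableFit.mul_norm_polyGrad_sub_gmlsFit_le (hst : StableFit m Φ x ε i h w)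
    (hΦ : ∀ s, 0 ≤ s → 0 ≤ Φ s) (hq : q ∈ vanishingPoly m (x i)) (hB : 0 ≤ B)
    (hlsq : 2 * lsqFunctional Φ x ε i u q ≤ w * B ^ 2) :
    h * ‖polyGrad (x i) q - polyGrad (x i) (gmlsFit m Φ x ε i u)‖ ≤ 2 * B := by
  rw [norm_sub_rev, ← polyGrad_sub]
  exact hst.mul_norm_polyGrad_le _ (totalDegree_gmlsFit_sub_le hΦ u hq) B hB
    ((lsqFunctional_gmlsFit_sub_le hΦ hq).trans hlsq)

theorem StableFit.sq_mul_abs_polyLaplacian_sub_gmlsFit_le (hst : StableFit m Φ x ε i h w)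
    (hΦ : ∀ s, 0 ≤ s → 0 ≤ Φ s) (hq : q ∈ vanishingPoly m (x i)) (hB : 0 ≤ B)
    (hlsq : 2 * lsqFunctional Φ x ε i u q ≤ w * B ^ 2) :
    h ^ 2 * |polyLaplacian (x i) q - polyLaplacian (x i) (gmlsFit m Φ x ε i u)| ≤ d * (2 * B) := by
  rw [abs_sub_comm, ← polyLaplacian_sub]
  exact hst.sq_mul_abs_polyLaplacian_le _ (totalDegree_gmlsFit_sub_le hΦ u hq) B hB
    ((lsqFunctional_gmlsFit_sub_le hΦ hq).trans hlsq)

end Stability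

section Consistency

variable {d m N : ℕ} {Ω S : Set (Pt d)} {φ : Pt d → ℝ} {Φ : ℝ → ℝ} {x : Fin N → Pt d} {ε : ℝ}
  {i : Fin N} {h w β : ℝ}

theorem exists_lsqFunctional_midTaylor_le (m : ℕ) (hS : RegularityRegion Ω S) (hΩ : IsCompact Ω)
    (hint : Ω ⊆ closure (interior Ω)) {R : ℝ} (hR : 0 ≤ R) (c W : ℝ) (hw : 0 < w) :
    ∃ β : ℝ, 0 ≤ β ∧ ∀ {N : ℕ} (x : Fin N → Pt d) (i : Fin N) {ε : ℝ} (hε : 0 < ε) {h : ℝ},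
      (∀ j, x j ∈ Ω) → 0 < h → h ≤ c * separationDistance x →
      ∀ Φ : ℝ → ℝ, WeightBounds Φ (R * h) w W →
      ∀ φ : Pt d → ℝ, ContDiffOn ℝ ((m + 1 : ℕ) : WithTop ℕ∞) φ S →
        2 * lsqFunctional Φ x ε i (topGrad x hε i (restrictNodal x ε i fun j => φ (x j)))
            (midTaylor m φ S (x i))
          ≤ w * (β * ckNorm (m + 1) S φ * h ^ (m + 1)) ^ 2 := by
  obtain ⟨A, hA, htaylor⟩ := hS.exists_taylor_bound m hΩ hint
  obtain ⟨n, hn⟩ := exists_card_nbr_le d (by positivity : 0 ≤ 2 * R) c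
  refine ⟨√(2 * n * W / w) * (A * (2 * R) ^ (m + 1)), by positivity,
    fun x i ε hε h hx hh hhc Φ hΦ φ hφ => ?_⟩
  have hW : 0 ≤ W := (hΦ.nonneg 0 le_rfl).trans (hΦ.le 0 le_rfl)
  have hck := ckNorm_nonneg (m + 1) S φ
  have hcard := hn x i ε h hh hhc
  rw [mul_assoc] at hcard
  have hres := hΦ.lsqFunctional_le (p := midTaylor m φ S (x i))
    (u := topGrad x hε i (restrictNodal x ε i fun j => φ (x j)))
    (η := A * ckNorm (m + 1) S φ * (2 * (R * h)) ^ (m + 1)) (fun j hj => ?_) hcard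
  · calc _ ≤ 2 * (n * ((A * ckNorm (m + 1) S φ * (2 * (R * h)) ^ (m + 1)) ^ 2 * W)) := by gcongr
      _ = w * (2 * n * W / w) * (A * (2 * R) ^ (m + 1) * ckNorm (m + 1) S φ * h ^ (m + 1)) ^ 2 := by
        field_simp
        ring
      _ = _ := by
        simp only [mul_pow, Real.sq_sqrt (by positivity : 0 ≤ 2 * n * W / w)]
        ring
  · simp only [topGrad, restrictNodal]
    rw [edgeMid_eq_midpoint, polyEval_midpoint_midTaylor, sub_sub_sub_cancel_right]
    refine (htaylor φ hφ _ (hx i) _ (hx j)).trans ?_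
    rw [dist_eq_norm']
    gcongr

theorem abs_laplacianWithin_sub_polyLaplacian_midTaylor_le (hm : 0 < m) (hS : RegularityRegion Ω S)
    (hφ : ContDiffOn ℝ ((m + 1 : ℕ) : WithTop ℕ∞) φ S) {a : Pt d} (ha : a ∈ S)
    (ha' : a ∈ closure (interior S)) (hh : 0 ≤ h) :
    |InnerProductSpace.laplacianWithin φ S a - 1 / 4 * polyLaplacian a (midTaylor m φ S a)|
      ≤ d * (ckNorm (m + 1) S φ * h ^ (m - 1)) := by
  rcases (Nat.succ_le_of_lt hm).eq_or_lt with rfl | hm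
  · simpa [polyLaplacian_midTaylor_one] using (abs_laplacianWithin_le hS.uniqueDiff ha).trans
      (mul_le_mul_of_nonneg_left (norm_iteratedFDerivWithin_le_ckNorm hS.compact hS.uniqueDiff hφ
        le_rfl ha) d.cast_nonneg)
  · rw [polyLaplacian_midTaylor hm (hφ.of_le (by exact_mod_cast m.le_succ)) hS.uniqueDiff ha ha',
      ← mul_assoc, one_div, inv_mul_cancel₀ four_ne_zero, one_mul, sub_self, abs_zero]
    have := ckNorm_nonneg (m + 1) S φ
    positivity

theorem StableFit.abs_laplacianWithin_sub_gmlsDiv_le (hst : StableFit m Φ x ε i h w)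
    (hΦ : ∀ s, 0 ≤ s → 0 ≤ Φ s) (hm : 0 < m) (hS : RegularityRegion Ω S)
    (hφ : ContDiffOn ℝ ((m + 1 : ℕ) : WithTop ℕ∞) φ S) (hi : x i ∈ S)
    (hi' : x i ∈ closure (interior S)) (hh : 0 < h) (hβ : 0 ≤ β) {u : EdgeSpace x ε i}
    (hlsq : 2 * lsqFunctional Φ x ε i u (midTaylor m φ S (x i))
      ≤ w * (β * ckNorm (m + 1) S φ * h ^ (m + 1)) ^ 2) :
    |InnerProductSpace.laplacianWithin φ S (x i) - gmlsDiv m Φ x ε i u|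
      ≤ (d + d * β / 2) * (ckNorm (m + 1) S φ * h ^ (m - 1)) := by
  have hck := ckNorm_nonneg (m + 1) S φ
  have hfit : |polyLaplacian (x i) (midTaylor m φ S (x i))
      - polyLaplacian (x i) (gmlsFit m Φ x ε i u)|
        ≤ d * (2 * (β * ckNorm (m + 1) S φ * h ^ (m - 1))) := by
    refine le_of_mul_le_mul_left ((hst.sq_mul_abs_polyLaplacian_sub_gmlsFit_le hΦ
      (midTaylor_mem_vanishingPoly m φ S (x i)) (by positivity) hlsq).trans_eq ?_) (pow_pos hh 2)
    rw [show m + 1 = m - 1 + 2 by omega, pow_add]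
    ring
  have htaylor := abs_laplacianWithin_sub_polyLaplacian_midTaylor_le hm hS hφ hi hi' hh.le
  rw [gmlsDiv]
  rw [abs_le] at *
  constructor <;> linarith

theorem StableFit.norm_gradientWithin_sub_gmlsField_le (hst : StableFit m Φ x ε i h w)
    (hΦ : ∀ s, 0 ≤ s → 0 ≤ Φ s) (hm : 0 < m) (hS : UniqueDiffOn ℝ S)
    (hφ : ContDiffOn ℝ (m : WithTop ℕ∞) φ S) (hi : x i ∈ S)
    (hi' : x i ∈ closure (interior S)) (hh : 0 < h) (hβ : 0 ≤ β) {u : EdgeSpace x ε i}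
    (hlsq : 2 * lsqFunctional Φ x ε i u (midTaylor m φ S (x i))
      ≤ w * (β * ckNorm (m + 1) S φ * h ^ (m + 1)) ^ 2) :
    ‖gradientWithin φ S (x i) - gmlsField m Φ x ε i u‖
      ≤ β * (ckNorm (m + 1) S φ * h ^ m) := by
  have hck := ckNorm_nonneg (m + 1) S φ
  have hgrad : gradientWithin φ S (x i) = (1 / 2 : ℝ) • polyGrad (x i) (midTaylor m φ S (x i)) := by
    rw [polyGrad_midTaylor hm.ne' hφ hS hi hi', smul_smul]
    norm_num
  rw [hgrad, gmlsField, ← smul_sub, norm_smul, Real.norm_of_nonneg (by norm_num)]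
  refine le_of_mul_le_mul_left ?_ hh
  linear_combination hst.mul_norm_polyGrad_sub_gmlsFit_le hΦ
    (midTaylor_mem_vanishingPoly m φ S (x i)) (by positivity) hlsq / 2

end Consistency

theorem DomainCondition.fillDistance_pos {d N : ℕ} {Ω : Set (Pt d)} {r θ : ℝ}
    (hΩ : DomainCondition Ω r θ) {x : Fin N → Pt d} {i : Fin N} (hi : x i ∈ Ω) :
    0 < fillDistance x Ω :=
  StaggeredGMLS.fillDistance_pos hΩ.compact
    (hΩ.cone_condition.infinite hΩ.radius_pos hΩ.sin_angle_pos hi) i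

theorem theorem5p1_general {d m : ℕ} (hm : 0 < m) {Ω S : Set (Pt d)} {r θ : ℝ}
    (hΩ : DomainCondition Ω r θ) (hS : RegularityRegion Ω S) (c : ℝ) {w : ℝ} (hw : 0 < w)
    (W : ℝ) :
    ∃ C : ℝ, 0 < C ∧ ∀ {N : ℕ} (x : Fin N → Pt d) (h : ℝ), (∀ j, x j ∈ Ω) →
      fillDistance x Ω ≤ h → h ≤ c * separationDistance x → coneConst m θ * h ≤ r →
      ∀ Φ : ℝ → ℝ, WeightBounds Φ (2 * coneConst m θ * h) w W →
      ∀ (i : Fin N) (ε : ℝ) (hε : 0 < ε), coneConst m θ * h < ε →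
      ∀ φ : Pt d → ℝ, ContDiffOn ℝ ((m + 1 : ℕ) : WithTop ℕ∞) φ S →
      ∀ g : EdgeSpace x ε i, g = topGrad x hε i (restrictNodal x ε i fun j => φ (x j)) →
        (∃! p, IsFit m Φ x ε i g p) ∧
        |InnerProductSpace.laplacianWithin φ S (x i) - gmlsDiv m Φ x ε i g|
          ≤ C * h ^ (m - 1) * ckNorm (m + 1) S φ ∧
        ‖gradientWithin φ S (x i) - gmlsField m Φ x ε i g‖
          ≤ C * h ^ m * ckNorm (m + 1) S φ := by
  have hint : Ω ⊆ closure (interior Ω) := fun _ =>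
    hΩ.cone_condition.mem_closure_interior hΩ.radius_pos hΩ.sin_angle_pos
  have hR : 0 < 2 * coneConst m θ := mul_pos two_pos (coneConst_pos hm hΩ.sin_angle_pos)
  obtain ⟨β, hβ, hcons⟩ := exists_lsqFunctional_midTaylor_le m hS hΩ.compact hint hR.le c W hw
  refine ⟨d + d * β / 2 + β + 1, by positivity, ?_⟩
  rintro N x h hx hfill hhc hhr Φ hΦ i ε hε hRε φ hφ _ rfl
  have hh : 0 < h := (hΩ.fillDistance_pos (hx i)).trans_le hfill
  have hdense : ∀ z ∈ Ω, ∃ j, dist z (x j) ≤ h := fun z hz =>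
    (exists_dist_le_fillDistance hΩ.compact i hz).imp fun _ hj => hj.trans hfill
  have hst : StableFit m Φ x ε i h w := hΦ.stableFit hw hΩ hm hh hhr hdense (hx i) hRε
  have hi' : x i ∈ closure (interior S) := closure_mono (interior_mono hS.subset) (hint (hx i))
  have hlsq := hcons x i hε hx hh hhc Φ hΦ φ hφ
  have hck := ckNorm_nonneg (m + 1) S φ
  refine ⟨hst.existsUnique_isFit hΦ.nonneg _, ?_, ?_⟩
  · refine (hst.abs_laplacianWithin_sub_gmlsDiv_le hΦ.nonneg hm hS hφ (hS.subset (hx i)) hi' hh hβ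
      hlsq).trans ?_
    rw [mul_assoc, mul_comm (h ^ _)]
    exact mul_le_mul_of_nonneg_right (by linarith) (by positivity)
  · refine (hst.norm_gradientWithin_sub_gmlsField_le hΦ.nonneg hm hS.uniqueDiff
      (hφ.of_le (by exact_mod_cast m.le_succ)) (hS.subset (hx i)) hi' hh hβ hlsq).trans ?_
    rw [mul_assoc, mul_comm (h ^ _)]
    exact mul_le_mul_of_nonneg_right (by linarith [show 0 ≤ d + d * β / 2 by positivity])
      (by positivity)

end StaggeredGMLS

end

theorem theorem5p1 {d m : ℕ} (hm : 0 < m)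
    (Ω S : Set (StaggeredGMLS.Pt d)) (r θ : ℝ)
    (hΩ : StaggeredGMLS.DomainCondition Ω r θ)
    (hS : StaggeredGMLS.RegularityRegion Ω S)
    (c : ℝ) (ψ : ℝ → ℝ) :
    ∃ C : ℝ, 0 < C ∧
      ∀ (N : ℕ) (x : Fin N → StaggeredGMLS.Pt d) (h δ : ℝ),
        StaggeredGMLS.NodeCondition Ω r θ m c x →
        h = StaggeredGMLS.fillDistance x Ω →
        δ = 2 * StaggeredGMLS.coneConst m θ * h →
      ∀ Φ : ℝ → ℝ, StaggeredGMLS.WeightCondition Φ δ →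
        (∀ s, 0 ≤ s → Φ s = ψ (s / δ)) →
      ∀ (i : Fin N) (ε : ℝ) (hε : 0 < ε), δ ≤ ε →
      ∀ φ : StaggeredGMLS.Pt d → ℝ, ContDiffOn ℝ ((m + 1 : ℕ) : WithTop ℕ∞) φ S →
      ∀ g : StaggeredGMLS.EdgeSpace x ε i,
        g = StaggeredGMLS.topGrad x hε i
              (StaggeredGMLS.restrictNodal x ε i (fun j => φ (x j))) →
        (∃! p, StaggeredGMLS.IsFit m Φ x ε i g p) ∧
        |InnerProductSpace.laplacianWithin φ S (x i) - StaggeredGMLS.gmlsDiv m Φ x ε i g|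
          ≤ C * h ^ (m - 1) * StaggeredGMLS.ckNorm (m + 1) S φ ∧
        ‖gradientWithin φ S (x i) - StaggeredGMLS.gmlsField m Φ x ε i g‖
          ≤ C * h ^ m * StaggeredGMLS.ckNorm (m + 1) S φ := by
  obtain ⟨w, W, hw, hΦW⟩ := StaggeredGMLS.exists_weightBounds_of_profile ψ
  obtain ⟨C, hC, hmain⟩ := StaggeredGMLS.theorem5p1_general hm hΩ hS c hw W
  refine ⟨C, hC, ?_⟩
  rintro N x h δ hx rfl rfl Φ hΦ hψ i ε hε hδε φ hφ g hg
  have hcone := StaggeredGMLS.coneConst_pos hm hΩ.sin_angle_pos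
  have hfill := hΩ.fillDistance_pos (hx.mem i)
  refine hmain x _ hx.mem le_rfl hx.fill_le_sep ((le_div_iff₀' hcone).1 hx.fill_le) Φ
    (hΦW _ Φ (by positivity) hΦ hψ) i ε hε ?_ φ hφ g hg
  linarith [mul_pos hcone hfill]
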